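/- **Setting.** Let $\Omega\subset\mathbb R^d$ be the closure of a bounded open convex set, $Q=[0,1]\times\Omega$. Let $\mathbb S^n$ (resp. $\mathbb S^n_+$, $\mathbb S^n_{++}$) be the symmetric (resp. positive-semidefinite, positive-definite) real $n\times n$ matrices, $A\cdot B=\operatorname{tr}(A^{\mathrm T}B)$, $\mathbb X=\mathbb S^n\times\mathbb R^{n\times k}\times\mathbb R^{n\times n}$, and let $\mathcal M(\mathcal X,V)$ be the space of $V$-valued Radon measures on $\mathcal X$, with duality pairing $\langle\cdot,\cdot\rangle_{\mathcal X}$ with continuous $V$-valued functions. Let $\Lambda_1\in\mathbb S^k_+$, $\Lambda_2\in\mathbb S^n_{++}$, and let $\mathsf D^*$ be a first-order linear differential operator in the space variable, with constant coefficients, from $\mathbb S^n$-valued to $\mathbb R^{n\times k}$-valued fields, with $\mathsf D^*(I)=0$. Put $$\mathcal O_\Lambda=\{(A,B,C)\in\mathbb X:\ A+\tfrac12B\Lambda_1^2B^{\mathrm T}+\tfrac12C\Lambda_2^2C^{\mathrm T}\preceq0\},\qquad J_\Lambda(X,Y,Z)=\sup_{(A,B,C)\in\mathcal O_\Lambda}X\cdot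 A+Y\cdot B+Z\cdot C .$$ For $\mu=(\mathsf G,\mathsf q,\mathsf R)\in\mathcal M(Q,\mathbb X)$ let $\mathcal J_{\Lambda,Q}(\mu)=\int_QJ_\Lambda\big(\tfrac{d\mu}{d\lambda}\big)\,d\lambda\in[0,\infty]$, where $\lambda$ is any finite positive measure with $|\mu|\ll\lambda$ (the value does not depend on $\lambda$); $(G_\lambda,q_\lambda,R_\lambda)$ denotes the density of $\mu$ with respect to such a $\lambda$. For $\Phi\in C^1(Q,\mathbb S^n)$ let $L\Phi=(\partial_t\Phi,\mathsf D^*\Phi,\Phi)\in C(Q,\mathbb X)$ and $\Phi_t=\Phi(t,\cdot)$. For $\mathsf G_0,\mathsf G_1\in\mathcal M(\Omega,\mathbb S^n_+)$ let $\mathcal{CE}([0,1];\mathsf G_0,\mathsf G_1)$ be the set of all $\mu\in\mathcal M(Q,\mathbb X)$ that satisfy the matricial continuity equation $$\langle\mu,L\Phi\rangle_Q=\langle\mathsf G_1,\Phi_1\rangle_\Omega-\langle\mathsf G_0,\Phi_0\rangle_\Omega\qquad\forall\,\Phi\in C^1(Q,\mathbb S^n),$$ and let $$\mathrm{WB}_\Lambda^2(\mathsf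 G_0,\mathsf G_1)=\inf_{\mu\in\mathcal{CE}([0,1];\mathsf G_0,\mathsf G_1)}\mathcal J_{\Lambda,Q}(\mu).\tag{$\mathcal P$}$$ **Theorem.** Let $\mathsf G_0,\mathsf G_1\in\mathcal M(\Omega,\mathbb S^n_+)$. Then $\mathrm{WB}_\Lambda^2(\mathsf G_0,\mathsf G_1)<\infty$, problem $(\mathcal P)$ has a minimizer $\mu\in\mathcal{CE}([0,1];\mathsf G_0,\mathsf G_1)$, and there is no duality gap: $$\mathrm{WB}_\Lambda^2(\mathsf G_0,\mathsf G_1)=\sup\Big\{\langle\mathsf G_1,\Phi_1\rangle_\Omega-\langle\mathsf G_0,\Phi_0\rangle_\Omega:\ \Phi\in C^1(Q,\mathbb S^n),\ \partial_t\Phi+\tfrac12\mathsf D^*\Phi\,\Lambda_1^2(\mathsf D^*\Phi)^{\mathrm T}+\tfrac12\Phi\Lambda_2^2\Phi\preceq0\text{ on }Q\Big\}.$$ For $\Phi\in C^1(Q,\mathbb S^n)$, the supremum is attained at $\Phi$ if and only if there exists $\mu\in\mathcal{CE}([0,1];\mathsf G_0,\mathsf G_1)$ with $L\Phi\in\partial\mathcal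 J_{\Lambda,Q}(\mu)$ (the convex subdifferential of $\mathcal J_{\Lambda,Q}$ on $\mathcal M(Q,\mathbb X)$); equivalently, if and only if $\Phi$ satisfies the constraint of the dual problem and there exists $\mu=(\mathsf G,\mathsf q,\mathsf R)\in\mathcal{CE}([0,1];\mathsf G_0,\mathsf G_1)$ with $\mathsf G\in\mathcal M(Q,\mathbb S^n_+)$ such that $$q_\lambda=G_\lambda(\mathsf D^*\Phi)\Lambda_1^2,\qquad R_\lambda=G_\lambda\Phi\Lambda_2^2,\qquad G_\lambda\cdot\Big(\partial_t\Phi+\tfrac12\mathsf D^*\Phi\,\Lambda_1^2(\mathsf D^*\Phi)^{\mathrm T}+\tfrac12\Phi\Lambda_2^2\Phi\Big)=0$$ for $\lambda$-a.e. $(t,x)\in Q$. For each $\mu\in\mathcal{CE}([0,1];\mathsf G_0,\mathsf G_1)$ and each reference measure $\lambda$ the two conditions on $(\Phi,\mu)$ are equivalent, and when they hold $\mu$ is also a minimizer of $(\mathcal P)$. -/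

import Mathlib

open MeasureTheory Set
open scoped ENNReal

noncomputable section

namespace MatOT

/-- The Euclidean space `ℝ^d`. -/
abbrev E (d : ℕ) : Type := EuclideanSpace ℝ (Fin d)

/-- Real `r × s` matrices. -/
abbrev Mat (r s : ℕ) : Type := Matrix (Fin r) (Fin s) ℝ

/-- The Frobenius inner product `A · B = tr (Aᵀ B)`. -/
def frob {r s : ℕ} (A B : Mat r s) : ℝ := (A.transpose * B).trace

/-! ### Matrix-valued measures -/

section Measures

variable {α : Type*} [MeasurableSpace α] {r s : ℕ}

/-- The `(i, j)` entry of a matrix-valued measure, a finite signed measure. -/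
def entry (m : VectorMeasure α (Mat r s)) (i : Fin r) (j : Fin s) : SignedMeasure α :=
  m.mapRange (Matrix.entryAddMonoidHom ℝ i j) (continuous_id.matrix_elem i j)

/-- The duality pairing `⟨m, F⟩ = ∫ F · dm` between matrix-valued measures and matrix fields. -/
def pairing (m : VectorMeasure α (Mat r s)) (F : α → Mat r s) : ℝ :=
  ∑ i, ∑ j, VectorMeasure.integral (entry m i j) (fun x => F x i j)
    (ContinuousLinearMap.lsmul ℝ ℝ).flip

/-- The density `dm/dν` of a matrix-valued measure with respect to `ν`. -/
def density (m : VectorMeasure α (Mat r s)) (ν : Measure α) (x : α) : Mat r s :=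
  Matrix.of fun i j => (entry m i j).rnDeriv ν x

/-- The sum of the total variations of the entries; it has the same null sets as `|m|`. -/
def entryVariation (m : VectorMeasure α (Mat r s)) : Measure α :=
  ∑ i, ∑ j, (entry m i j).variation

/-- The measure takes positive-semidefinite values, i.e. lies in `M(α, S^r_+)`. -/
def IsPSDValued (m : VectorMeasure α (Mat r r)) : Prop :=
  ∀ A : Set α, (m A).PosSemidef

end Measures

/-- An element `μ = (G, q, R)` of `M(α, 𝕏)`, `𝕏 = S^n × ℝ^{n × k} × ℝ^{n × n}`. -/
structure Triple (α : Type*) [MeasurableSpace α] (n k : ℕ) where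
  G : VectorMeasure α (Mat n n)
  q : VectorMeasure α (Mat n k)
  R : VectorMeasure α (Mat n n)
  symm : ∀ A : Set α, (G A).IsSymm

section Action

variable {α : Type*} [MeasurableSpace α] {n k : ℕ}

/-- `ν` is a reference measure for `μ`: a finite positive measure with `|μ| ≪ ν`. -/
def IsReference (μ : Triple α n k) (ν : Measure α) : Prop :=
  IsFiniteMeasure ν ∧ μ.G ≪ᵥ ν.toENNRealVectorMeasure ∧ μ.q ≪ᵥ ν.toENNRealVectorMeasure ∧
    μ.R ≪ᵥ ν.toENNRealVectorMeasure

/-- A canonical reference measure of `μ`, equivalent to `|μ|`. -/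
def refMeasure (μ : Triple α n k) : Measure α :=
  entryVariation μ.G + entryVariation μ.q + entryVariation μ.R

/-- The pairing `⟨μ, Ξ⟩` of `M(α, 𝕏)` with `𝕏`-valued fields. -/
def pairing3 (μ : Triple α n k) (Ξ : α → Mat n n × Mat n k × Mat n n) : ℝ :=
  pairing μ.G (fun x => (Ξ x).1) + pairing μ.q (fun x => (Ξ x).2.1) +
    pairing μ.R (fun x => (Ξ x).2.2)

/-- `A + ½ B Λ₁² Bᵀ + ½ C Λ₂² Cᵀ`. -/
def hjExpr (Λ₁ : Mat k k) (Λ₂ : Mat n n) (p : Mat n n × Mat n k × Mat n n) : Mat n n :=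
  p.1 + (1 / 2 : ℝ) • (p.2.1 * Λ₁ ^ 2 * p.2.1.transpose) +
    (1 / 2 : ℝ) • (p.2.2 * Λ₂ ^ 2 * p.2.2.transpose)

/-- The closed convex set `O_Λ` of the triples `(A, B, C)` in `S^n × ℝ^{n × k} × ℝ^{n × n}` with
`A + ½ B Λ₁² Bᵀ + ½ C Λ₂² Cᵀ ⪯ 0`. -/
def OSet (Λ₁ : Mat k k) (Λ₂ : Mat n n) : Set (Mat n n × Mat n k × Mat n n) :=
  {p | p.1.IsSymm ∧ (-(hjExpr Λ₁ Λ₂ p)).PosSemidef}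

/-- The support function `J_Λ` of `O_Λ`, i.e. the conjugate of its indicator function.
Since `0 ∈ O_Λ`, the supremum is nonnegative and truncating the terms at `0` is harmless. -/
def J (Λ₁ : Mat k k) (Λ₂ : Mat n n) (X : Mat n n) (Y : Mat n k) (Z : Mat n n) : ℝ≥0∞ :=
  ⨆ p ∈ OSet Λ₁ Λ₂, ENNReal.ofReal (frob X p.1 + frob Y p.2.1 + frob Z p.2.2)

/-- The action functional `𝒥_Λ(μ) = ∫ J_Λ(dμ/dν) dν`, with the canonical reference measure. -/
def action (Λ₁ : Mat k k) (Λ₂ : Mat n n) (μ : Triple α n k) : ℝ≥0∞ :=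
  ∫⁻ x, J Λ₁ Λ₂ (density μ.G (refMeasure μ) x) (density μ.q (refMeasure μ) x)
    (density μ.R (refMeasure μ) x) ∂(refMeasure μ)

/-- `Ξ ∈ ∂𝒥_Λ(μ)`: `Ξ` is a subgradient of the action functional at `μ`. -/
def IsSubgradient (Λ₁ : Mat k k) (Λ₂ : Mat n n) (μ : Triple α n k)
    (Ξ : α → Mat n n × Mat n k × Mat n n) : Prop :=
  ∀ ν : Triple α n k,
    (action Λ₁ Λ₂ μ : EReal) + ((pairing3 ν Ξ - pairing3 μ Ξ : ℝ) : EReal) ≤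
      (action Λ₁ Λ₂ ν : EReal)

end Action

/-! ### The differential operator and the test fields -/

/-- A first-order linear differential operator `D^*` with constant coefficients on `ℝ^d`, mapping
`S^n`-valued fields to `ℝ^{n × k}`-valued fields, `D^* Φ = D₀ Φ + ∑ₗ D₁ₗ (∂ₗ Φ)`, such that
`D^* I = 0`. The coefficients are only ever applied to symmetric matrices. -/
structure DiffOp (d n k : ℕ) where
  D0 : Mat n n →ₗ[ℝ] Mat n k
  D1 : Fin d → (Mat n n →ₗ[ℝ] Mat n k)
  map_one : D0 1 = 0

section Fields

variable {d n k : ℕ}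

/-- The time-space domain `Q = [0,1] × Ω`. -/
def Q (Ω : Set (E d)) : Set (ℝ × E d) := Icc (0 : ℝ) 1 ×ˢ Ω

/-- The field `Φ` belongs to `C^1(Q, S^n)` (its values outside `Q` are irrelevant). -/
def IsC1 (Ω : Set (E d)) (Φ : ℝ × E d → Mat n n) : Prop :=
  (∀ z ∈ Q Ω, (Φ z).IsSymm) ∧ ∀ i j, ContDiffOn ℝ 1 (fun z => Φ z i j) (Q Ω)

/-- The directional derivative of `Φ` on `Q` in the time-space direction `v`, entry by entry. -/
def dirDeriv (Ω : Set (E d)) (v : ℝ × E d) (Φ : ℝ × E d → Mat n n) (z : ℝ × E d) : Mat n n :=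
  Matrix.of fun i j => fderivWithin ℝ (fun y => Φ y i j) (Q Ω) z v

/-- The time derivative `∂_t Φ`. -/
def dt (Ω : Set (E d)) (Φ : ℝ × E d → Mat n n) (z : ℝ × E d) : Mat n n :=
  dirDeriv Ω (1, 0) Φ z

/-- `D^* Φ`, with `D^*` acting on the space variable. -/
def DiffOp.apply (D : DiffOp d n k) (Ω : Set (E d)) (Φ : ℝ × E d → Mat n n) (z : ℝ × E d) :
    Mat n k :=
  D.D0 (Φ z) + ∑ l, D.D1 l (dirDeriv Ω (0, EuclideanSpace.single l 1) Φ z)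

/-- `L Φ = (∂_t Φ, D^* Φ, Φ)` as a field on `Q`. -/
def LOp (D : DiffOp d n k) (Ω : Set (E d)) (Φ : ℝ × E d → Mat n n) (z : Q Ω) :
    Mat n n × Mat n k × Mat n n :=
  (dt Ω Φ z, D.apply Ω Φ z, Φ z)

/-- `⟨G₁, Φ₁⟩ - ⟨G₀, Φ₀⟩`: the dual objective, which is also the pairing of `Φ` with
`δ₁(t) ⊗ G₁ - δ₀(t) ⊗ G₀`. -/
def endPairing {Ω : Set (E d)} (G₀ G₁ : VectorMeasure Ω (Mat n n)) (Φ : ℝ × E d → Mat n n) : ℝ :=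
  pairing G₁ (fun x => Φ (1, x)) - pairing G₀ (fun x => Φ (0, x))

/-- The set `CE([0,1]; G₀, G₁)` of the weak solutions `μ = (G, q, R)` of
`∂_t G + D q = R^sym + δ₀(t) ⊗ G₀ - δ₁(t) ⊗ G₁`, i.e.
`∫_Q ∂_t Φ · dG + D^* Φ · dq + Φ · dR = ∫_Ω Φ₁ · dG₁ - ∫_Ω Φ₀ · dG₀` for all `Φ ∈ C^1(Q, S^n)`;
equivalently `L^* μ = δ₁(t) ⊗ G₁ - δ₀(t) ⊗ G₀` in the dual of `C^1(Q, S^n)`. -/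
def CE (D : DiffOp d n k) {Ω : Set (E d)} (G₀ G₁ : VectorMeasure Ω (Mat n n)) :
    Set (Triple (Q Ω) n k) :=
  {μ | ∀ Φ : ℝ × E d → Mat n n, IsC1 Ω Φ → pairing3 μ (LOp D Ω Φ) = endPairing G₀ G₁ Φ}

/-- The squared weighted Wasserstein-Bures distance `WB²_Λ(G₀, G₁)`. -/
def WBsq (D : DiffOp d n k) (Λ₁ : Mat k k) (Λ₂ : Mat n n) {Ω : Set (E d)}
    (G₀ G₁ : VectorMeasure Ω (Mat n n)) : ℝ≥0∞ :=
  ⨅ μ ∈ CE D G₀ G₁, action Λ₁ Λ₂ μ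

/-- `μ` is a minimizer of the problem defining `WB²_Λ(G₀, G₁)`. -/
def IsMinimizer (D : DiffOp d n k) (Λ₁ : Mat k k) (Λ₂ : Mat n n) {Ω : Set (E d)}
    (G₀ G₁ : VectorMeasure Ω (Mat n n)) (μ : Triple (Q Ω) n k) : Prop :=
  μ ∈ CE D G₀ G₁ ∧ ∀ ν ∈ CE D G₀ G₁, action Λ₁ Λ₂ μ ≤ action Λ₁ Λ₂ ν

/-- The feasible fields of the dual problem: `Φ ∈ C^1(Q, S^n)` with
`∂_t Φ + ½ D^*Φ Λ₁² (D^*Φ)ᵀ + ½ Φ Λ₂² Φ ⪯ 0` on `Q`, i.e. `L Φ ∈ C(Q, O_Λ)`. -/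
def dualFeasible (D : DiffOp d n k) (Λ₁ : Mat k k) (Λ₂ : Mat n n) (Ω : Set (E d)) :
    Set (ℝ × E d → Mat n n) :=
  {Φ | IsC1 Ω Φ ∧ ∀ z : Q Ω, LOp D Ω Φ z ∈ OSet Λ₁ Λ₂}

/-- The value of the dual problem. -/
def dualValue (D : DiffOp d n k) (Λ₁ : Mat k k) (Λ₂ : Mat n n) {Ω : Set (E d)}
    (G₀ G₁ : VectorMeasure Ω (Mat n n)) : EReal :=
  ⨆ Φ ∈ dualFeasible D Λ₁ Λ₂ Ω, ((endPairing G₀ G₁ Φ : ℝ) : EReal)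

/-- The supremum in the dual problem is attained at `Φ`. -/
def IsDualMaximizer (D : DiffOp d n k) (Λ₁ : Mat k k) (Λ₂ : Mat n n) {Ω : Set (E d)}
    (G₀ G₁ : VectorMeasure Ω (Mat n n)) (Φ : ℝ × E d → Mat n n) : Prop :=
  Φ ∈ dualFeasible D Λ₁ Λ₂ Ω ∧ ((endPairing G₀ G₁ Φ : ℝ) : EReal) = dualValue D Λ₁ Λ₂ G₀ G₁

/-- The pointwise optimality conditions `q = G (D^*Φ) Λ₁²`, `R = G Φ Λ₂²` and
`G · (∂_t Φ + ½ D^*Φ Λ₁² (D^*Φ)ᵀ + ½ Φ Λ₂² Φ) = 0` for the densities with respect to `ν`,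
`ν`-almost everywhere on `Q`. -/
def PointwiseOptimal (D : DiffOp d n k) (Λ₁ : Mat k k) (Λ₂ : Mat n n) {Ω : Set (E d)}
    (Φ : ℝ × E d → Mat n n) (μ : Triple (Q Ω) n k) (ν : Measure (Q Ω)) : Prop :=
  ∀ᵐ z ∂ν,
    density μ.q ν z = density μ.G ν z * D.apply Ω Φ z * Λ₁ ^ 2 ∧
    density μ.R ν z = density μ.G ν z * Φ z * Λ₂ ^ 2 ∧
    frob (density μ.G ν z) (hjExpr Λ₁ Λ₂ (LOp D Ω Φ z)) = 0

end Fields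

end MatOT

end

open MatOT

/-!
# Duality for the weighted Wasserstein–Bures problem

Both problems are governed by the support functional of the convex set of continuous fields `Ξ` on
`Q` with values in `O_Λ`. Approximating measurable selections by continuous fields, which stay in
`O_Λ` by convexity, shows that the action `𝒥_Λ(μ)` is the supremum of `⟨μ, Ξ⟩` over these fields,
whatever reference measure is used to compute it (`lintegral_J_le`,
`ofReal_pairing3_le_lintegral_J`). Weak duality is then immediate: for `μ ∈ CE` and `Φ` dual
feasible, the dual objective is `⟨μ, L Φ⟩ ≤ 𝒥_Λ(μ)`.

Strong duality and existence of a minimizer come from one application of the Hahn–Banach theorem.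
The dual objective depends only on the third component of `L Φ`, hence is a linear functional on
the range of `L`, and it is bounded there, on the fields satisfying the constraint, by the dual
value `c`. This value is finite: along `t`, the constraint gives the Riccati-type inequality
`∂_t Φ ⪯ -½ Φ Λ₂² Φ`, which bounds `Φ₁` from above and `Φ₀` from below by multiples of the identity
(`riccati_bound`, `exists_bound_of_dualFeasible`). Since `D^* I = 0`, the field `-t η I` satisfies
the constraint with slack (`exists_slack_field`), so the constraint set has an interior point in
the range of `L`, and the gauge of the set about this point controls an extension of the functional
to all continuous fields that is still bounded by `c` on the constraint set
(`exists_extension_le_on_constraintFields`). By a version of the Riesz–Markov–Kakutani theorem for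
signed measures (`exists_signedMeasure_of_bounded`) the extension is given by some
`μ ∈ M(Q, 𝕏)`. Agreement on the range of `L` says `μ ∈ CE`, and the bound says `𝒥_Λ(μ) ≤ c`.

The action is a support functional, so `Ξ ∈ ∂𝒥_Λ(μ)` means that `Ξ` takes values in `O_Λ` and
`𝒥_Λ(μ) = ⟨μ, Ξ⟩` (`isSubgradient_iff`). Equality of the integrals is equality almost everywhere of
`J_Λ` at the density of `μ` with the inner product of this density and `Ξ`
(`action_eq_pairing3_iff_ae`), and for matrices `X`, `Y`, `Z` the point `(A, B, C) ∈ O_Λ` attains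
`J_Λ(X, Y, Z)` exactly when `X ⪰ 0`, `Y = X B Λ₁²`, `Z = X C Λ₂²` and complementary slackness holds
(`forall_inner3_le_iff`).
-/

namespace MatOT

open Matrix

/-! ### The Frobenius inner product -/

variable {r s n k : ℕ}

lemma frob_eq_sum (A B : Mat r s) : frob A B = ∑ i, ∑ j, A i j * B i j := by
  simp only [frob, trace, diag_apply, mul_apply, transpose_apply]
  exact Finset.sum_comm

@[simp] lemma frob_add_right (A B B' : Mat r s) : frob A (B + B') = frob A B + frob A B' := by
  simp [frob, Matrix.mul_add]

@[simp] lemma frob_sub_left (A A' B : Mat r s) : frob (A - A') B = frob A B - frob A' B := by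
  simp [frob, Matrix.sub_mul]

@[simp] lemma frob_sub_right (A B B' : Mat r s) : frob A (B - B') = frob A B - frob A B' := by
  simp [frob, Matrix.mul_sub]

@[simp] lemma frob_smul_right (c : ℝ) (A B : Mat r s) : frob A (c • B) = c * frob A B := by
  simp [frob]

@[simp] lemma frob_neg_right (A B : Mat r s) : frob A (-B) = -frob A B := by
  simp [frob]

@[simp] lemma frob_zero_right (A : Mat r s) : frob A 0 = 0 := by simp [frob]

lemma frob_comm (A B : Mat r s) : frob A B = frob B A := by
  simp only [frob_eq_sum, mul_comm]

lemma frob_vecMulVec (v w : Fin r → ℝ) (A : Mat r r) : frob (vecMulVec v w) A = v ⬝ᵥ A *ᵥ w := by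
  simp only [frob_eq_sum, vecMulVec_apply, dotProduct, mulVec, Finset.mul_sum]
  exact Finset.sum_congr rfl fun i _ => Finset.sum_congr rfl fun j _ => by ring

lemma frob_vecMulVec_right (v w : Fin r → ℝ) (A : Mat r r) :
    frob A (vecMulVec v w) = v ⬝ᵥ A *ᵥ w := by
  rw [frob_comm, frob_vecMulVec]

lemma dotProduct_self_nonneg (v : Fin r → ℝ) : 0 ≤ v ⬝ᵥ v :=
  Finset.sum_nonneg fun _ _ => mul_self_nonneg _

lemma frob_self_nonneg (A : Mat r s) : 0 ≤ frob A A := by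
  rw [frob_eq_sum]
  exact Finset.sum_nonneg fun i _ => Finset.sum_nonneg fun j _ => mul_self_nonneg _

lemma eq_zero_of_frob_self (A : Mat r s) (h : frob A A = 0) : A = 0 := by
  rw [frob_eq_sum] at h
  replace h := (Finset.sum_eq_zero_iff_of_nonneg
    fun i _ => Finset.sum_nonneg fun j _ => mul_self_nonneg (A i j)).1 h
  ext i j
  have := (Finset.sum_eq_zero_iff_of_nonneg fun j _ => mul_self_nonneg (A i j)).1
    (h i (Finset.mem_univ _)) j (Finset.mem_univ _)
  simpa using this

lemma posSemidef_iff_real (A : Mat r r) :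
    A.PosSemidef ↔ A.IsSymm ∧ ∀ v, 0 ≤ v ⬝ᵥ A *ᵥ v := by
  rw [posSemidef_iff_dotProduct_mulVec]
  simp [IsHermitian, IsSymm]

/-- Two positive semidefinite matrices have a nonnegative inner product. -/
lemma frob_nonneg_of_posSemidef {A B : Mat r r} (hA : A.PosSemidef) (hB : B.PosSemidef) :
    0 ≤ frob A B := by
  obtain ⟨C, rfl⟩ : ∃ C : Mat r r, B = C * Cᵀ := by
    open scoped MatrixOrder in
    obtain ⟨C, hC⟩ := CStarAlgebra.nonneg_iff_eq_mul_star_self.1 hB.nonneg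
    exact ⟨C, by simpa [star_eq_conjTranspose] using hC⟩
  have h := (hA.conjTranspose_mul_mul_same C).trace_nonneg
  have hs : Aᵀ = A := ((posSemidef_iff_real A).1 hA).1
  rwa [conjTranspose_eq_transpose_of_trivial, Matrix.mul_assoc, Matrix.trace_mul_comm,
    Matrix.mul_assoc, ← hs] at h

lemma frob_nonpos_of_posSemidef {A B : Mat r r} (hA : A.PosSemidef) (hB : (-B).PosSemidef) :
    frob A B ≤ 0 := by
  have := frob_nonneg_of_posSemidef hA hB
  simp only [frob_neg_right] at this
  linarith

lemma posSemidef_vecMulVec (v : Fin r → ℝ) : (vecMulVec v v).PosSemidef := by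
  simpa using posSemidef_vecMulVec_self_star v

/-! ### Pointwise duality between densities and the constraint set -/

/-- The inner product of `𝕏 = S^n × ℝ^{n × k} × ℝ^{n × n}`. -/
def inner3 (D p : Mat n n × Mat n k × Mat n n) : ℝ :=
  frob D.1 p.1 + frob D.2.1 p.2.1 + frob D.2.2 p.2.2

lemma inner3_add_right (D p q : Mat n n × Mat n k × Mat n n) :
    inner3 D (p + q) = inner3 D p + inner3 D q := by
  simp [inner3]; ring

lemma inner3_smul_right (c : ℝ) (D p : Mat n n × Mat n k × Mat n n) :
    inner3 D (c • p) = c * inner3 D p := by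
  simp [inner3]; ring

lemma inner3_zero_right (D : Mat n n × Mat n k × Mat n n) : inner3 D 0 = 0 := by
  simp [inner3]

lemma continuous_inner3_right (D : Mat n n × Mat n k × Mat n n) : Continuous (inner3 D) := by
  unfold inner3 frob
  fun_prop

lemma dotProduct_mul_sq_mul (Λ : Mat s s) (hΛ : Λ.IsSymm) (B : Mat r s) (v : Fin r → ℝ) :
    v ⬝ᵥ (B * Λ ^ 2 * Bᵀ) *ᵥ v = (Λ *ᵥ (Bᵀ *ᵥ v)) ⬝ᵥ (Λ *ᵥ (Bᵀ *ᵥ v)) := by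
  have : B * Λ ^ 2 * Bᵀ = (Λ * Bᵀ)ᵀ * (Λ * Bᵀ) := by
    rw [transpose_mul, hΛ.eq, transpose_transpose]
    simp only [pow_two, Matrix.mul_assoc]
  rw [this, ← mulVec_mulVec, dotProduct_mulVec, vecMul_transpose, ← mulVec_mulVec]

lemma posSemidef_mul_sq_mul (Λ : Mat s s) (hΛ : Λ.IsSymm) (B : Mat r s) :
    (B * Λ ^ 2 * Bᵀ).PosSemidef := by
  refine (posSemidef_iff_real _).2 ⟨?_, fun v => ?_⟩
  · simp [IsSymm, transpose_mul, hΛ.eq, Matrix.mul_assoc]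
  · rw [dotProduct_mul_sq_mul Λ hΛ]
    exact dotProduct_self_nonneg _

/-- The quadratic form of `A + ½ B Λ₁² Bᵀ + ½ C Λ₂² Cᵀ`. -/
lemma dotProduct_hjExpr (Λ₁ : Mat k k) (Λ₂ : Mat n n) (h₁ : Λ₁.IsSymm) (h₂ : Λ₂.IsSymm)
    (p : Mat n n × Mat n k × Mat n n) (v : Fin n → ℝ) :
    v ⬝ᵥ hjExpr Λ₁ Λ₂ p *ᵥ v = v ⬝ᵥ p.1 *ᵥ v
      + 1 / 2 * ((Λ₁ *ᵥ (p.2.1ᵀ *ᵥ v)) ⬝ᵥ (Λ₁ *ᵥ (p.2.1ᵀ *ᵥ v)))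
      + 1 / 2 * ((Λ₂ *ᵥ (p.2.2ᵀ *ᵥ v)) ⬝ᵥ (Λ₂ *ᵥ (p.2.2ᵀ *ᵥ v))) := by
  simp only [hjExpr, add_mulVec, smul_mulVec, dotProduct_add, dotProduct_smul, smul_eq_mul,
    dotProduct_mul_sq_mul _ h₁, dotProduct_mul_sq_mul _ h₂]

lemma isSymm_hjExpr (Λ₁ : Mat k k) (Λ₂ : Mat n n) (h₁ : Λ₁.IsSymm) (h₂ : Λ₂.IsSymm)
    (p : Mat n n × Mat n k × Mat n n) (hp : p.1.IsSymm) : (hjExpr Λ₁ Λ₂ p).IsSymm := by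
  have a := ((posSemidef_iff_real _).1 (posSemidef_mul_sq_mul Λ₁ h₁ p.2.1)).1
  have b := ((posSemidef_iff_real _).1 (posSemidef_mul_sq_mul Λ₂ h₂ p.2.2)).1
  exact (hp.add (a.smul _)).add (b.smul _)

lemma mem_OSet_iff (Λ₁ : Mat k k) (Λ₂ : Mat n n) (h₁ : Λ₁.IsSymm) (h₂ : Λ₂.IsSymm)
    (p : Mat n n × Mat n k × Mat n n) :
    p ∈ OSet Λ₁ Λ₂ ↔ p.1.IsSymm ∧ ∀ v, v ⬝ᵥ hjExpr Λ₁ Λ₂ p *ᵥ v ≤ 0 := by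
  simp only [OSet, mem_ofPred_eq, posSemidef_iff_real, neg_mulVec, dotProduct_neg, neg_nonneg]
  refine and_congr_right fun hp => and_iff_right ?_
  exact (isSymm_hjExpr Λ₁ Λ₂ h₁ h₂ p hp).neg

lemma zero_mem_OSet (Λ₁ : Mat k k) (Λ₂ : Mat n n) : 0 ∈ OSet Λ₁ Λ₂ := by
  refine ⟨Matrix.transpose_zero, ?_⟩
  simpa [hjExpr] using Matrix.PosSemidef.zero

lemma sq_combo_le (Λ : Mat s s) (B B' : Mat r s) (v : Fin r → ℝ) {a b : ℝ} (ha : 0 ≤ a)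
    (hb : 0 ≤ b) (hab : a + b = 1) :
    (Λ *ᵥ ((a • B + b • B')ᵀ *ᵥ v)) ⬝ᵥ (Λ *ᵥ ((a • B + b • B')ᵀ *ᵥ v)) ≤
      a * ((Λ *ᵥ (Bᵀ *ᵥ v)) ⬝ᵥ (Λ *ᵥ (Bᵀ *ᵥ v))) +
        b * ((Λ *ᵥ (B'ᵀ *ᵥ v)) ⬝ᵥ (Λ *ᵥ (B'ᵀ *ᵥ v))) := by
  simp only [transpose_add, transpose_smul, add_mulVec, smul_mulVec, mulVec_add, mulVec_smul]
  set x := Λ *ᵥ (Bᵀ *ᵥ v)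
  set y := Λ *ᵥ (B'ᵀ *ᵥ v)
  have h := mul_nonneg (mul_nonneg ha hb) (dotProduct_self_nonneg (x - y))
  obtain rfl : b = 1 - a := by linarith
  simp only [add_dotProduct, dotProduct_add, sub_dotProduct, dotProduct_sub, smul_dotProduct,
    dotProduct_smul, smul_eq_mul, dotProduct_comm y x] at h ⊢
  nlinarith [h]

/-- The quadratic form of `hjExpr` is convex. -/
lemma dotProduct_hjExpr_combo_le (Λ₁ : Mat k k) (Λ₂ : Mat n n) (h₁ : Λ₁.IsSymm)
    (h₂ : Λ₂.IsSymm) (p q : Mat n n × Mat n k × Mat n n) (v : Fin n → ℝ) {a b : ℝ} (ha : 0 ≤ a)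
    (hb : 0 ≤ b) (hab : a + b = 1) :
    v ⬝ᵥ hjExpr Λ₁ Λ₂ (a • p + b • q) *ᵥ v ≤
      a * (v ⬝ᵥ hjExpr Λ₁ Λ₂ p *ᵥ v) + b * (v ⬝ᵥ hjExpr Λ₁ Λ₂ q *ᵥ v) := by
  simp only [dotProduct_hjExpr _ _ h₁ h₂]
  have e₁ := sq_combo_le Λ₁ p.2.1 q.2.1 v ha hb hab
  have e₂ := sq_combo_le Λ₂ p.2.2 q.2.2 v ha hb hab
  simp only [Prod.fst_add, Prod.snd_add, Prod.smul_fst, Prod.smul_snd] at *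
  have e₃ : v ⬝ᵥ (a • p.1 + b • q.1) *ᵥ v = a * (v ⬝ᵥ p.1 *ᵥ v) + b * (v ⬝ᵥ q.1 *ᵥ v) := by
    simp [add_mulVec, smul_mulVec]
  rw [e₃]
  linarith

lemma convex_OSet (Λ₁ : Mat k k) (Λ₂ : Mat n n) (h₁ : Λ₁.IsSymm) (h₂ : Λ₂.IsSymm) :
    Convex ℝ (OSet Λ₁ Λ₂) := by
  intro p hp q hq a b ha hb hab
  rw [mem_OSet_iff _ _ h₁ h₂] at *
  refine ⟨(hp.1.smul a).add (hq.1.smul b), fun v => ?_⟩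
  have := dotProduct_hjExpr_combo_le Λ₁ Λ₂ h₁ h₂ p q v ha hb hab
  nlinarith [hp.2 v, hq.2 v]

lemma frob_mul_sq_mul (X : Mat r r) (hX : X.IsSymm) (Λ : Mat s s) (hΛ : Λ.IsSymm)
    (B B' : Mat r s) : frob (X * B * Λ ^ 2) B' = frob X (B' * Λ ^ 2 * Bᵀ) := by
  have h2 : (Λ ^ 2)ᵀ = Λ ^ 2 := by rw [transpose_pow, hΛ.eq]
  simp only [frob, transpose_mul, h2, hX.eq]
  rw [Matrix.trace_mul_comm, Matrix.trace_mul_comm X]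
  rw [show B' * (Λ ^ 2 * (Bᵀ * X)) = B' * Λ ^ 2 * Bᵀ * X by simp only [Matrix.mul_assoc]]

lemma frob_mul_sq_mul_comm (X : Mat r r) (hX : X.IsSymm) (Λ : Mat s s) (hΛ : Λ.IsSymm)
    (B B' : Mat r s) : frob (X * B * Λ ^ 2) B' = frob (X * B' * Λ ^ 2) B := by
  have h2 : (Λ ^ 2)ᵀ = Λ ^ 2 := by rw [transpose_pow, hΛ.eq]
  rw [frob_mul_sq_mul X hX Λ hΛ, frob_comm (X * B' * Λ ^ 2)]
  simp only [frob, hX.eq]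
  rw [Matrix.trace_mul_comm Bᵀ]
  simp only [Matrix.mul_assoc]

lemma frob_mul_sq_mul_nonneg (X : Mat r r) (hX : X.PosSemidef) (Λ : Mat s s) (hΛ : Λ.IsSymm)
    (B : Mat r s) : 0 ≤ frob (X * B * Λ ^ 2) B := by
  rw [frob_mul_sq_mul X ((posSemidef_iff_real X).1 hX).1 Λ hΛ]
  exact frob_nonneg_of_posSemidef hX (posSemidef_mul_sq_mul Λ hΛ B)

/-- Young's inequality for the form `(B, B') ↦ X · (B Λ² B'ᵀ)`. -/
lemma frob_mul_sq_mul_le (X : Mat r r) (hX : X.PosSemidef) (Λ : Mat s s) (hΛ : Λ.IsSymm)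
    (B B' : Mat r s) : frob (X * B * Λ ^ 2) B' ≤
      1 / 2 * frob X (B * Λ ^ 2 * Bᵀ) + 1 / 2 * frob X (B' * Λ ^ 2 * B'ᵀ) := by
  have hs := ((posSemidef_iff_real X).1 hX).1
  have h := frob_mul_sq_mul_nonneg X hX Λ hΛ (B - B')
  rw [← frob_mul_sq_mul X hs Λ hΛ, ← frob_mul_sq_mul X hs Λ hΛ]
  have e := frob_mul_sq_mul_comm X hs Λ hΛ B B'
  simp only [Matrix.mul_sub, Matrix.sub_mul, frob_sub_left, frob_sub_right] at h
  linarith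

lemma frob_hjExpr (Λ₁ : Mat k k) (Λ₂ : Mat n n) (X : Mat n n) (p : Mat n n × Mat n k × Mat n n) :
    frob X (hjExpr Λ₁ Λ₂ p) = frob X p.1 + 1 / 2 * frob X (p.2.1 * Λ₁ ^ 2 * p.2.1ᵀ)
      + 1 / 2 * frob X (p.2.2 * Λ₂ ^ 2 * p.2.2ᵀ) := by
  simp [hjExpr]

/-- For a positive semidefinite `X`, the support function of `OSet` at `(X, X B Λ₁², X C Λ₂²)` is
`½ X · B Λ₁² Bᵀ + ½ X · C Λ₂² Cᵀ`. -/
lemma inner3_le_of_mem_OSet (Λ₁ : Mat k k) (Λ₂ : Mat n n) (h₁ : Λ₁.IsSymm) (h₂ : Λ₂.IsSymm)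
    (X : Mat n n) (hX : X.PosSemidef) (B : Mat n k) (C : Mat n n)
    {p : Mat n n × Mat n k × Mat n n} (hp : p ∈ OSet Λ₁ Λ₂) :
    inner3 (X, X * B * Λ₁ ^ 2, X * C * Λ₂ ^ 2) p ≤
      1 / 2 * frob X (B * Λ₁ ^ 2 * Bᵀ) + 1 / 2 * frob X (C * Λ₂ ^ 2 * Cᵀ) := by
  have a := frob_mul_sq_mul_le X hX Λ₁ h₁ B p.2.1
  have b := frob_mul_sq_mul_le X hX Λ₂ h₂ C p.2.2
  have c := frob_nonpos_of_posSemidef hX hp.2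
  rw [frob_hjExpr] at c
  simp only [inner3]
  linarith

/-- The first-order condition at a maximum, for perturbations in the direction `E`. -/
lemma eq_zero_of_forall_sq_le {r s : ℕ} (E : Mat r s) (c : ℝ)
    (h : ∀ t : ℝ, t * frob E E ≤ t ^ 2 * c) : E = 0 := by
  refine eq_zero_of_frob_self E (le_antisymm ?_ (frob_self_nonneg E))
  -- with this `t` the quadratic term is at most half of the linear one
  have h1 := h (frob E E / (2 * (|c| + 1)))
  have hc : 0 < |c| + 1 := by positivity
  have hE := frob_self_nonneg E
  set f := frob E E
  by_contra! hlt
  have e1 : f / (2 * (|c| + 1)) * f = 2 * (|c| + 1) * (f / (2 * (|c| + 1))) ^ 2 := by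
    field_simp
  rw [e1] at h1
  have : 0 < (f / (2 * (|c| + 1))) ^ 2 := by positivity
  nlinarith [le_abs_self c, abs_nonneg c]

/-- A density `D = (X, Y, Z)` is exposed by `p = (A, B, C)` in the constraint set if and only if
`X` is positive semidefinite, `Y = X B Λ₁²`, `Z = X C Λ₂²`, and complementary slackness holds. -/
lemma forall_inner3_le_iff (Λ₁ : Mat k k) (Λ₂ : Mat n n) (h₁ : Λ₁.IsSymm) (h₂ : Λ₂.IsSymm)
    (D : Mat n n × Mat n k × Mat n n) (hD : D.1.IsSymm)
    {p : Mat n n × Mat n k × Mat n n} (hp : p ∈ OSet Λ₁ Λ₂) :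
    (∀ q ∈ OSet Λ₁ Λ₂, inner3 D q ≤ inner3 D p) ↔
      D.1.PosSemidef ∧ D.2.1 = D.1 * p.2.1 * Λ₁ ^ 2 ∧ D.2.2 = D.1 * p.2.2 * Λ₂ ^ 2 ∧
        frob D.1 (hjExpr Λ₁ Λ₂ p) = 0 := by
  obtain ⟨X, Y, Z⟩ := D
  obtain ⟨A, B, C⟩ := p
  simp only at hD ⊢
  constructor
  · intro h
    have hX : X.PosSemidef := by
      refine (posSemidef_iff_real X).2 ⟨hD, fun v => ?_⟩
      have hmem : (A - vecMulVec v v, B, C) ∈ OSet Λ₁ Λ₂ := by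
        refine ⟨hp.1.sub (((posSemidef_iff_real _).1 (posSemidef_vecMulVec v)).1), ?_⟩
        have := hp.2.add (posSemidef_vecMulVec v)
        convert this using 1
        simp only [hjExpr]
        abel
      have := h _ hmem
      simp only [inner3, frob_sub_right, frob_vecMulVec_right] at this
      linarith
    have hslack := frob_nonpos_of_posSemidef hX hp.2
    rw [frob_hjExpr] at hslack
    simp only at hslack
    -- the competitor with `A' = -½ B' Λ₁² B'ᵀ - ½ C' Λ₂² C'ᵀ`
    have key : ∀ (B' : Mat n k) (C' : Mat n n),
        frob Y B' + frob Z C' - 1 / 2 * frob X (B' * Λ₁ ^ 2 * B'ᵀ)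
          - 1 / 2 * frob X (C' * Λ₂ ^ 2 * C'ᵀ) ≤ frob X A + frob Y B + frob Z C := by
      intro B' C'
      have s₁ := ((posSemidef_iff_real _).1 (posSemidef_mul_sq_mul Λ₁ h₁ B')).1
      have s₂ := ((posSemidef_iff_real _).1 (posSemidef_mul_sq_mul Λ₂ h₂ C')).1
      have hmem : (-((1 / 2 : ℝ) • (B' * Λ₁ ^ 2 * B'ᵀ)) - (1 / 2 : ℝ) • (C' * Λ₂ ^ 2 * C'ᵀ), B', C')
          ∈ OSet Λ₁ Λ₂ := by
        refine ⟨(s₁.smul _).neg.sub (s₂.smul _), ?_⟩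
        convert PosSemidef.zero (R := ℝ) (n := Fin n) using 1
        simp only [hjExpr]
        abel
      have := h _ hmem
      simp only [inner3, frob_sub_right, frob_neg_right, frob_smul_right] at this
      linarith
    have hY : Y - X * B * Λ₁ ^ 2 = 0 := by
      refine eq_zero_of_forall_sq_le _ (1 / 2 * frob X ((Y - X * B * Λ₁ ^ 2) * Λ₁ ^ 2 *
        (Y - X * B * Λ₁ ^ 2)ᵀ)) fun t => ?_
      have := key (B + t • (Y - X * B * Λ₁ ^ 2)) C
      set H := Y - X * B * Λ₁ ^ 2 with hH
      have e0 : frob H H = frob Y H - frob (X * B * Λ₁ ^ 2) H := by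
        conv_lhs => rw [hH, frob_sub_left]
      have e1 := frob_mul_sq_mul_comm X hD Λ₁ h₁ B H
      rw [frob_mul_sq_mul X hD Λ₁ h₁ B H, frob_mul_sq_mul X hD Λ₁ h₁ H B] at e1
      rw [frob_mul_sq_mul X hD Λ₁ h₁ B H] at e0
      simp only [transpose_add, transpose_smul, Matrix.mul_add, Matrix.add_mul, Matrix.mul_smul,
        Matrix.smul_mul, frob_add_right, frob_smul_right] at this
      rw [← e1] at this
      rw [e0]
      linarith
    have hZ : Z - X * C * Λ₂ ^ 2 = 0 := by
      refine eq_zero_of_forall_sq_le _ (1 / 2 * frob X ((Z - X * C * Λ₂ ^ 2) * Λ₂ ^ 2 *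
        (Z - X * C * Λ₂ ^ 2)ᵀ)) fun t => ?_
      have := key B (C + t • (Z - X * C * Λ₂ ^ 2))
      set H := Z - X * C * Λ₂ ^ 2 with hH
      have e0 : frob H H = frob Z H - frob (X * C * Λ₂ ^ 2) H := by
        conv_lhs => rw [hH, frob_sub_left]
      have e1 := frob_mul_sq_mul_comm X hD Λ₂ h₂ C H
      rw [frob_mul_sq_mul X hD Λ₂ h₂ C H, frob_mul_sq_mul X hD Λ₂ h₂ H C] at e1
      rw [frob_mul_sq_mul X hD Λ₂ h₂ C H] at e0
      simp only [transpose_add, transpose_smul, Matrix.mul_add, Matrix.add_mul, Matrix.mul_smul,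
        Matrix.smul_mul, frob_add_right, frob_smul_right] at this
      rw [← e1] at this
      rw [e0]
      linarith
    refine ⟨hX, sub_eq_zero.1 hY, sub_eq_zero.1 hZ, ?_⟩
    rw [frob_hjExpr]
    refine le_antisymm hslack ?_
    have := key B C
    simp only
    linarith
  · rintro ⟨hX, rfl, rfl, h0⟩ q hq
    refine (inner3_le_of_mem_OSet Λ₁ Λ₂ h₁ h₂ X hX B C hq).trans (le_of_eq ?_)
    rw [frob_hjExpr] at h0
    simp only [inner3, frob_mul_sq_mul X hD Λ₁ h₁, frob_mul_sq_mul X hD Λ₂ h₂] at h0 ⊢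
    linarith

/-! ### Densities of matrix-valued measures -/

section Densities

variable {α : Type*} [MeasurableSpace α] {r s n k : ℕ}

/-- The integral of a bounded function against a signed measure, in terms of its density. -/
lemma integral_signedMeasure_eq (σ : SignedMeasure α) (ν : Measure α) [IsFiniteMeasure ν]
    (hσ : σ ≪ᵥ ν.toENNRealVectorMeasure) (f : α → ℝ) (hf : Measurable f) (C : ℝ)
    (hC : ∀ x, |f x| ≤ C) :
    VectorMeasure.integral σ f (ContinuousLinearMap.lsmul ℝ ℝ).flip =
      ∫ x, σ.rnDeriv ν x * f x ∂ν := by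
  have hint := SignedMeasure.integrable_rnDeriv σ ν
  have hmeas := SignedMeasure.measurable_rnDeriv σ ν
  set g := σ.rnDeriv ν with hg
  have hσ' : σ = ν.withDensityᵥ g := (SignedMeasure.withDensityᵥ_rnDeriv_eq σ ν hσ).symm
  have : IsFiniteMeasure (ν.withDensity fun x => ENNReal.ofReal (g x)) :=
    isFiniteMeasure_withDensity_ofReal hint.2
  have : IsFiniteMeasure (ν.withDensity fun x => ENNReal.ofReal (-g x)) :=
    isFiniteMeasure_withDensity_ofReal hint.neg.2
  have hfi : ∀ (τ : Measure α) [IsFiniteMeasure τ], τ.toSignedMeasure.Integrable f := by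
    intro τ _
    rw [VectorMeasure.Integrable, Measure.variation_toSignedMeasure]
    exact Integrable.of_bound hf.aestronglyMeasurable C (Filter.Eventually.of_forall hC)
  have hgf : Integrable (fun x => g x * f x) ν :=
    hint.mul_bdd (c := C) hf.aestronglyMeasurable (Filter.Eventually.of_forall hC)
  rw [hσ', withDensityᵥ_eq_withDensity_pos_part_sub_withDensity_neg_part hint,
    VectorMeasure.integral_sub_vectorMeasure (hfi _) (hfi _),
    VectorMeasure.integral_toSignedMeasure, VectorMeasure.integral_toSignedMeasure,
    integral_withDensity_eq_integral_toReal_smul hmeas.ennreal_ofReal (by simp),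
    integral_withDensity_eq_integral_toReal_smul (f := fun x => ENNReal.ofReal (-g x))
      hmeas.neg.ennreal_ofReal (by simp)]
  have hp : Integrable (fun x => (ENNReal.ofReal (g x)).toReal • f x) ν := by
    refine (hint.pos_part.mul_bdd (c := C) hf.aestronglyMeasurable
      (Filter.Eventually.of_forall hC)).congr (Filter.Eventually.of_forall fun x => ?_)
    simp [ENNReal.toReal_ofReal']
  have hn : Integrable (fun x => (ENNReal.ofReal (-g x)).toReal • f x) ν := by
    refine (hint.neg_part.mul_bdd (c := C) hf.aestronglyMeasurable
      (Filter.Eventually.of_forall hC)).congr (Filter.Eventually.of_forall fun x => ?_)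
    simp [ENNReal.toReal_ofReal']
  rw [← integral_sub hp hn]
  refine integral_congr_ae (Filter.Eventually.of_forall fun x => ?_)
  simp only [ENNReal.toReal_ofReal', smul_eq_mul]
  rw [← sub_mul, max_zero_sub_eq_self]

@[simp] lemma entry_apply (m : VectorMeasure α (Mat r s)) (i : Fin r) (j : Fin s) (A : Set α) :
    entry m i j A = m A i j := rfl

lemma entry_absolutelyContinuous {m : VectorMeasure α (Mat r s)} {ν : Measure α}
    (h : m ≪ᵥ ν.toENNRealVectorMeasure) (i : Fin r) (j : Fin s) :
    entry m i j ≪ᵥ ν.toENNRealVectorMeasure := by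
  intro A hA
  simp [h hA]

lemma measurable_density_apply (m : VectorMeasure α (Mat r s)) (ν : Measure α) (i : Fin r)
    (j : Fin s) : Measurable fun x => density m ν x i j :=
  SignedMeasure.measurable_rnDeriv _ _

lemma integrable_density_apply (m : VectorMeasure α (Mat r s)) (ν : Measure α) (i : Fin r)
    (j : Fin s) : Integrable (fun x => density m ν x i j) ν :=
  SignedMeasure.integrable_rnDeriv _ _

lemma measurable_frob_density (m : VectorMeasure α (Mat r s)) (ν : Measure α) (A : Mat r s) :
    Measurable fun x => frob (density m ν x) A := by
  simp only [frob_eq_sum]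
  exact Finset.measurable_sum _ fun i _ => Finset.measurable_sum _ fun j _ =>
    (measurable_density_apply m ν i j).mul_const _

lemma setIntegral_density {m : VectorMeasure α (Mat r s)} {ν : Measure α} [IsFiniteMeasure ν]
    (h : m ≪ᵥ ν.toENNRealVectorMeasure) (i : Fin r) (j : Fin s) {A : Set α}
    (hA : MeasurableSet A) : ∫ x in A, density m ν x i j ∂ν = m A i j := by
  have := SignedMeasure.withDensityᵥ_rnDeriv_eq (entry m i j) ν (entry_absolutelyContinuous h i j)
  rw [← entry_apply, ← this, withDensityᵥ_apply (SignedMeasure.integrable_rnDeriv _ _) hA]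
  rfl

lemma isSymm_density {m : VectorMeasure α (Mat r r)} (hm : ∀ A, (m A).IsSymm) (ν : Measure α)
    (x : α) : (density m ν x).IsSymm := by
  ext i j
  have : entry m j i = entry m i j := by
    ext A _
    exact (hm A).apply i j
  simp [density, this]

lemma IsPSDValued.isSymm {m : VectorMeasure α (Mat r r)} (hm : IsPSDValued m) (A : Set α) :
    (m A).IsSymm := ((posSemidef_iff_real _).1 (hm A)).1

/-- The quadratic form of the density integrates to that of the measure. -/
lemma setIntegral_dotProduct_density {m : VectorMeasure α (Mat r r)} {ν : Measure α}
    [IsFiniteMeasure ν] (h : m ≪ᵥ ν.toENNRealVectorMeasure) (v : Fin r → ℝ) {A : Set α}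
    (hA : MeasurableSet A) :
    ∫ x in A, v ⬝ᵥ density m ν x *ᵥ v ∂ν = v ⬝ᵥ m A *ᵥ v := by
  simp only [dotProduct, mulVec, Finset.mul_sum]
  have hi : ∀ i j, Integrable (fun x => v i * (density m ν x i j * v j)) (ν.restrict A) :=
    fun i j => (((integrable_density_apply m ν i j).restrict).mul_const _).const_mul _
  rw [integral_finsetSum _ fun i _ => integrable_finsetSum _ fun j _ => hi i j]
  refine Finset.sum_congr rfl fun i _ => ?_
  rw [integral_finsetSum _ fun j _ => hi i j]
  refine Finset.sum_congr rfl fun j _ => ?_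
  rw [integral_const_mul, integral_mul_const, setIntegral_density h i j hA]

/-- A symmetric matrix-valued measure takes positive semidefinite values if and only if its
density does almost everywhere. -/
lemma isPSDValued_iff_ae {m : VectorMeasure α (Mat r r)} (hm : ∀ A, (m A).IsSymm) {ν : Measure α}
    [IsFiniteMeasure ν] (h : m ≪ᵥ ν.toENNRealVectorMeasure) :
    IsPSDValued m ↔ ∀ᵐ x ∂ν, (density m ν x).PosSemidef := by
  have hint : ∀ v : Fin r → ℝ, Integrable (fun x => v ⬝ᵥ density m ν x *ᵥ v) ν := by
    intro v
    simp only [dotProduct, mulVec, Finset.mul_sum]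
    exact integrable_finsetSum _ fun i _ => integrable_finsetSum _ fun j _ =>
      ((integrable_density_apply m ν i j).mul_const _).const_mul _
  constructor
  · intro hp
    have h1 : ∀ᵐ x ∂ν, ∀ l : ℕ, 0 ≤ TopologicalSpace.denseSeq (Fin r → ℝ) l ⬝ᵥ
        density m ν x *ᵥ TopologicalSpace.denseSeq (Fin r → ℝ) l := by
      refine ae_all_iff.2 fun l => ae_nonneg_of_forall_setIntegral_nonneg (hint _) ?_
      intro A hA _
      rw [setIntegral_dotProduct_density h _ hA]
      exact ((posSemidef_iff_real _).1 (hp A)).2 _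
    filter_upwards [h1] with x hx
    refine (posSemidef_iff_real _).2 ⟨isSymm_density hm ν x, fun v => ?_⟩
    have hcl : IsClosed {w : Fin r → ℝ | 0 ≤ w ⬝ᵥ density m ν x *ᵥ w} :=
      isClosed_le continuous_const (by fun_prop)
    refine (hcl.closure_subset_iff.2 ?_)
      ((TopologicalSpace.denseRange_denseSeq (Fin r → ℝ)).closure_range ▸ mem_univ v)
    rintro _ ⟨l, rfl⟩
    exact hx l
  · intro hp A
    by_cases hA : MeasurableSet A
    · refine (posSemidef_iff_real _).2 ⟨hm A, fun v => ?_⟩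
      rw [← setIntegral_dotProduct_density h _ hA]
      refine integral_nonneg_of_ae (ae_restrict_of_ae ?_)
      filter_upwards [hp] with x hx
      exact ((posSemidef_iff_real _).1 hx).2 v
    · rw [m.not_measurable hA]
      exact PosSemidef.zero

lemma entryVariation_absolutelyContinuous (m : VectorMeasure α (Mat r s)) {ν : Measure α}
    (h : entryVariation m ≤ ν) : m ≪ᵥ ν.toENNRealVectorMeasure := by
  refine VectorMeasure.AbsolutelyContinuous.mk fun A hA hν => ?_
  rw [Measure.toENNRealVectorMeasure_apply_measurable hA] at hν
  have h0 : entryVariation m A = 0 := le_antisymm ((h A).trans hν.le) bot_le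
  simp only [entryVariation, Measure.finsetSum_apply, Finset.sum_eq_zero_iff, Finset.mem_univ,
    true_implies] at h0
  ext i j
  have := VectorMeasure.enorm_measure_le_variation (entry m i j) A
  rw [h0 i j] at this
  simpa using this

instance (m : VectorMeasure α (Mat r s)) : IsFiniteMeasure (entryVariation m) := by
  have h : ∀ i j, IsFiniteMeasure (entry m i j).variation := fun i j => by
    rw [← SignedMeasure.totalVariation_eq_variation, SignedMeasure.totalVariation]
    infer_instance
  unfold entryVariation
  infer_instance

lemma isReference_refMeasure (μ : Triple α n k) : IsReference μ (refMeasure μ) := by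
  refine ⟨by unfold refMeasure; infer_instance, ?_, ?_, ?_⟩
  · exact entryVariation_absolutelyContinuous _ (Measure.le_iff.2 fun A _ => by
      simp only [refMeasure, Measure.add_apply]; rw [add_assoc]; exact le_self_add)
  · exact entryVariation_absolutelyContinuous _ (Measure.le_iff.2 fun A _ => by
      simp only [refMeasure, Measure.add_apply]
      rw [add_comm (entryVariation μ.G A), add_assoc]; exact le_self_add)
  · exact entryVariation_absolutelyContinuous _ (Measure.le_iff.2 fun A _ => by
      simp only [refMeasure, Measure.add_apply]; exact le_add_self)

/-- The density of `μ = (G, q, R)` with respect to `ν`. -/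
noncomputable def density3 (μ : Triple α n k) (ν : Measure α) (x : α) :
    Mat n n × Mat n k × Mat n n :=
  (density μ.G ν x, density μ.q ν x, density μ.R ν x)

lemma isSymm_density3 (μ : Triple α n k) (ν : Measure α) (x : α) :
    (density3 μ ν x).1.IsSymm := isSymm_density μ.symm ν x

lemma measurable_inner3_density (μ : Triple α n k) (ν : Measure α)
    (p : Mat n n × Mat n k × Mat n n) : Measurable fun x => inner3 (density3 μ ν x) p :=
  ((measurable_frob_density _ _ _).add (measurable_frob_density _ _ _)).add
    (measurable_frob_density _ _ _)

end Densities

section Pairing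

variable {α : Type*} [TopologicalSpace α] [CompactSpace α] [MeasurableSpace α] [BorelSpace α]
  {r s n k : ℕ}

lemma exists_bound_of_continuous {β : Type*} [TopologicalSpace β] [CompactSpace β] {f : β → ℝ}
    (hf : Continuous f) : ∃ C, ∀ x, |f x| ≤ C := by
  obtain ⟨C, hC⟩ := isCompact_univ.exists_bound_of_continuousOn hf.continuousOn
  exact ⟨C, fun x => hC x (mem_univ x)⟩

lemma integrable_frob_density (m : VectorMeasure α (Mat r s)) (ν : Measure α)
    {F : α → Mat r s} (hF : Continuous F) :
    Integrable (fun x => frob (density m ν x) (F x)) ν := by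
  simp only [frob_eq_sum]
  refine integrable_finsetSum _ fun i _ => integrable_finsetSum _ fun j _ => ?_
  have hc : Continuous fun x => F x i j := hF.matrix_elem i j
  obtain ⟨C, hC⟩ := exists_bound_of_continuous hc
  exact (integrable_density_apply m ν i j).mul_bdd (c := C) hc.measurable.aestronglyMeasurable
    (Filter.Eventually.of_forall hC)

/-- `⟨m, F⟩ = ∫ (dm/dν) · F dν` for a continuous field `F`. -/
lemma pairing_eq_integral {m : VectorMeasure α (Mat r s)} {ν : Measure α} [IsFiniteMeasure ν]
    (h : m ≪ᵥ ν.toENNRealVectorMeasure) {F : α → Mat r s} (hF : Continuous F) :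
    pairing m F = ∫ x, frob (density m ν x) (F x) ∂ν := by
  have hint : ∀ i j, Integrable (fun x => density m ν x i j * F x i j) ν := by
    intro i j
    have hc : Continuous fun x => F x i j := hF.matrix_elem i j
    obtain ⟨C, hC⟩ := exists_bound_of_continuous hc
    exact (integrable_density_apply m ν i j).mul_bdd (c := C)
      hc.measurable.aestronglyMeasurable (Filter.Eventually.of_forall hC)
  simp only [frob_eq_sum, pairing]
  rw [integral_finsetSum _ fun i _ => integrable_finsetSum _ fun j _ => hint i j]
  refine Finset.sum_congr rfl fun i _ => ?_
  rw [integral_finsetSum _ fun j _ => hint i j]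
  refine Finset.sum_congr rfl fun j _ => ?_
  have hc : Continuous fun x => F x i j := hF.matrix_elem i j
  obtain ⟨C, hC⟩ := exists_bound_of_continuous hc
  exact integral_signedMeasure_eq (entry m i j) ν (entry_absolutelyContinuous h i j) _
    hc.measurable C hC

lemma integrable_inner3_density (μ : Triple α n k) (ν : Measure α)
    {Ξ : α → Mat n n × Mat n k × Mat n n} (hΞ : Continuous Ξ) :
    Integrable (fun x => inner3 (density3 μ ν x) (Ξ x)) ν :=
  ((integrable_frob_density _ _ hΞ.fst).add (integrable_frob_density _ _ hΞ.snd.fst)).add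
    (integrable_frob_density _ _ hΞ.snd.snd)

lemma pairing3_eq_integral {μ : Triple α n k} {ν : Measure α} (h : IsReference μ ν)
    {Ξ : α → Mat n n × Mat n k × Mat n n} (hΞ : Continuous Ξ) :
    pairing3 μ Ξ = ∫ x, inner3 (density3 μ ν x) (Ξ x) ∂ν := by
  obtain ⟨h0, h1, h2, h3⟩ := h
  have i1 := integrable_frob_density μ.G ν hΞ.fst
  have i2 := integrable_frob_density μ.q ν hΞ.snd.fst
  have i3 := integrable_frob_density μ.R ν hΞ.snd.snd
  rw [pairing3, pairing_eq_integral h1 hΞ.fst, pairing_eq_integral h2 hΞ.snd.fst,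
    pairing_eq_integral h3 hΞ.snd.snd, ← integral_add i1 i2]
  exact (integral_add (i1.add i2) i3).symm

/-- A positive semidefinite field pairs nonnegatively with a measure in `M(α, S^r_+)`. -/
lemma pairing_nonneg {m : VectorMeasure α (Mat r r)} (hm : IsPSDValued m) {F : α → Mat r r}
    (hF : Continuous F) (hp : ∀ x, (F x).PosSemidef) : 0 ≤ pairing m F := by
  have h := entryVariation_absolutelyContinuous m le_rfl
  rw [pairing_eq_integral h hF]
  refine integral_nonneg_of_ae ?_
  filter_upwards [(isPSDValued_iff_ae hm.isSymm h).1 hm] with x hx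
  exact frob_nonneg_of_posSemidef hx (hp x)

lemma pairing_add (m : VectorMeasure α (Mat r s)) {F G : α → Mat r s} (hF : Continuous F)
    (hG : Continuous G) : pairing m (fun x => F x + G x) = pairing m F + pairing m G := by
  have h := entryVariation_absolutelyContinuous m le_rfl
  have hFG : Continuous fun x => F x + G x := hF.add hG
  rw [pairing_eq_integral h hF, pairing_eq_integral h hG, pairing_eq_integral h hFG,
    ← integral_add (integrable_frob_density _ _ hF) (integrable_frob_density _ _ hG)]
  simp

lemma pairing_smul (m : VectorMeasure α (Mat r s)) (c : ℝ) {F : α → Mat r s}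
    (hF : Continuous F) : pairing m (fun x => c • F x) = c * pairing m F := by
  have h := entryVariation_absolutelyContinuous m le_rfl
  have hcF : Continuous fun x => c • F x := hF.const_smul c
  rw [pairing_eq_integral h hF, pairing_eq_integral h hcF, ← integral_const_mul]
  simp

end Pairing

/-! ### The action as a support functional -/

section Action

variable {α : Type*} [MetricSpace α] [CompactSpace α] [MeasurableSpace α] [BorelSpace α]
  {n k : ℕ}

lemma ofReal_integral_le_lintegral {β : Type*} [MeasurableSpace β] {ν : Measure β} {f : β → ℝ}
    (hf : Integrable f ν) : ENNReal.ofReal (∫ x, f x ∂ν) ≤ ∫⁻ x, ENNReal.ofReal (f x) ∂ν := by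
  rw [integral_eq_lintegral_pos_part_sub_lintegral_neg_part hf]
  exact (ENNReal.ofReal_le_ofReal (sub_le_self _ ENNReal.toReal_nonneg)).trans
    ENNReal.ofReal_toReal_le

/-- Indicators are almost everywhere limits of continuous functions with values in `[0, 1]`. -/
lemma exists_continuous_tendsto_indicator (ν : Measure α) [IsFiniteMeasure ν] {A : Set α}
    (hA : MeasurableSet A) : ∃ φ : ℕ → α → ℝ, (∀ m, Continuous (φ m)) ∧
      (∀ m x, φ m x ∈ Icc (0 : ℝ) 1) ∧
      ∀ᵐ x ∂ν, Filter.Tendsto (fun m => φ m x) Filter.atTop (nhds (A.indicator 1 x)) := by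
  have hL : MemLp (A.indicator (1 : α → ℝ)) 1 ν :=
    (memLp_const (1 : ℝ)).indicator hA
  have hex : ∀ m : ℕ, ∃ g : BoundedContinuousFunction α ℝ,
      eLpNorm (A.indicator (1 : α → ℝ) - ⇑g) 1 ν ≤ ((m : ℝ≥0∞) + 1)⁻¹ ∧ MemLp (⇑g) 1 ν :=
    fun m => hL.exists_boundedContinuous_eLpNorm_sub_le ENNReal.one_ne_top (by simp)
  choose g hg hgL using hex
  have hlim : Filter.Tendsto (fun m => eLpNorm (⇑(g m) - A.indicator (1 : α → ℝ)) 1 ν)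
      Filter.atTop (nhds 0) := by
    have h0 : Filter.Tendsto (fun m : ℕ => ((m : ℝ≥0∞) + 1)⁻¹) Filter.atTop (nhds 0) := by
      have := (Filter.tendsto_add_atTop_iff_nat 1).2 ENNReal.tendsto_inv_nat_nhds_zero
      simpa using this
    refine tendsto_of_tendsto_of_tendsto_of_le_of_le tendsto_const_nhds h0
      (fun _ => zero_le) fun m => ?_
    rw [eLpNorm_sub_comm]
    exact hg m
  obtain ⟨ns, -, hns⟩ := (tendstoInMeasure_of_tendsto_eLpNorm one_ne_zero
    (fun m => (hgL m).1) hL.1 hlim).exists_seq_tendsto_ae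
  refine ⟨fun m x => max 0 (min 1 (g (ns m) x)), fun m => ?_, fun m x => ?_, ?_⟩
  · exact continuous_const.max (continuous_const.min (g (ns m)).continuous)
  · exact ⟨le_max_left _ _, max_le zero_le_one (min_le_left _ _)⟩
  · filter_upwards [hns] with x hx
    have := (tendsto_const_nhds (x := (0 : ℝ))).max ((tendsto_const_nhds (x := (1 : ℝ))).min hx)
    convert this using 2
    by_cases h : x ∈ A <;> simp [h]

variable (Λ₁ : Mat k k) (Λ₂ : Mat n n)

/-- `u` is a dominated limit of the functions `(dμ/dν) · Ξ`, where `Ξ` are continuous fields with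
values in the constraint set. -/
def IsActionLimit (μ : Triple α n k) (ν : Measure α) (u : α → ℝ) : Prop :=
  ∃ (Ξ : ℕ → α → Mat n n × Mat n k × Mat n n) (b : α → ℝ),
    (∀ m, Continuous (Ξ m)) ∧ (∀ m x, Ξ m x ∈ OSet Λ₁ Λ₂) ∧ Integrable b ν ∧
    (∀ m x, |inner3 (density3 μ ν x) (Ξ m x)| ≤ b x) ∧
    ∀ᵐ x ∂ν, Filter.Tendsto (fun m => inner3 (density3 μ ν x) (Ξ m x)) Filter.atTop (nhds (u x))

/-- Dominated limits are stable under maxima with `(dμ/dν) · p`: the fields are glued along the set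
where `p` does better, which keeps them in the constraint set by convexity. -/
lemma IsActionLimit.max {Λ₁ : Mat k k} {Λ₂ : Mat n n} (h₁ : Λ₁.IsSymm) (h₂ : Λ₂.IsSymm)
    {μ : Triple α n k} {ν : Measure α} [IsFiniteMeasure ν]
    {u : α → ℝ} (hu : IsActionLimit Λ₁ Λ₂ μ ν u) (hum : Measurable u)
    {p : Mat n n × Mat n k × Mat n n} (hp : p ∈ OSet Λ₁ Λ₂) :
    IsActionLimit Λ₁ Λ₂ μ ν fun x => max (u x) (inner3 (density3 μ ν x) p) := by
  obtain ⟨Ξ, b, hc, hO, hb, hle, hlim⟩ := hu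
  set h := fun x => inner3 (density3 μ ν x) p with hh
  have hhm : Measurable h := measurable_inner3_density μ ν p
  have hhi : Integrable h ν := integrable_inner3_density μ ν continuous_const
  obtain ⟨φ, hφc, hφI, hφ⟩ := exists_continuous_tendsto_indicator ν
    (measurableSet_lt hum hhm)
  have hexp : ∀ m x, inner3 (density3 μ ν x) (φ m x • p + (1 - φ m x) • Ξ m x) =
      φ m x * h x + (1 - φ m x) * inner3 (density3 μ ν x) (Ξ m x) := fun m x => by
    rw [inner3_add_right, inner3_smul_right, inner3_smul_right]
  refine ⟨fun m x => φ m x • p + (1 - φ m x) • Ξ m x, fun x => |h x| + b x, fun m => ?_,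
    fun m x => ?_, hhi.abs.add hb, fun m x => ?_, ?_⟩
  · exact ((hφc m).smul continuous_const).add ((continuous_const.sub (hφc m)).smul (hc m))
  · exact convex_OSet Λ₁ Λ₂ h₁ h₂ hp (hO m x) (hφI m x).1 (sub_nonneg.2 (hφI m x).2) (by ring)
  · rw [hexp]
    obtain ⟨h0, h1⟩ := hφI m x
    refine (abs_add_le _ _).trans (add_le_add ?_ ?_)
    · rw [abs_mul, abs_of_nonneg h0]
      exact mul_le_of_le_one_left (abs_nonneg _) h1
    · rw [abs_mul, abs_of_nonneg (sub_nonneg.2 h1)]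
      exact (mul_le_of_le_one_left (abs_nonneg _) (by linarith)).trans (hle m x)
  · filter_upwards [hlim, hφ] with x hx hφx
    simp only [hexp]
    have := (hφx.mul_const (h x)).add ((hφx.const_sub 1).mul hx)
    convert this using 2
    by_cases hlt : u x < h x
    · simp only [mem_ofPred_eq, hlt, indicator_of_mem, Pi.one_apply, one_mul, sub_self, zero_mul,
        add_zero]
      exact max_eq_right hlt.le
    · simpa [hlt] using not_lt.1 hlt

lemma IsActionLimit.integral_le {Λ₁ : Mat k k} {Λ₂ : Mat n n} {μ : Triple α n k} {ν : Measure α}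
    (hν : IsReference μ ν) {u : α → ℝ} (hu : IsActionLimit Λ₁ Λ₂ μ ν u) {c : ℝ}
    (hc : ∀ Ξ : α → Mat n n × Mat n k × Mat n n, Continuous Ξ → (∀ x, Ξ x ∈ OSet Λ₁ Λ₂) →
      pairing3 μ Ξ ≤ c) : Integrable u ν ∧ ∫ x, u x ∂ν ≤ c := by
  obtain ⟨Ξ, b, hcont, hO, hb, hle, hlim⟩ := hu
  have hm : ∀ m, AEStronglyMeasurable (fun x => inner3 (density3 μ ν x) (Ξ m x)) ν :=
    fun m => (integrable_inner3_density μ ν (hcont m)).1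
  constructor
  · refine hb.mono' (aestronglyMeasurable_of_tendsto_ae _ hm hlim) ?_
    filter_upwards [hlim] with x hx
    exact le_of_tendsto hx.abs (Filter.Eventually.of_forall fun m => hle m x)
  · refine le_of_tendsto (tendsto_integral_of_dominated_convergence b hm hb
      (fun m => Filter.Eventually.of_forall fun x => hle m x) hlim)
      (Filter.Eventually.of_forall fun m => ?_)
    rw [← pairing3_eq_integral hν (hcont m)]
    exact hc _ (hcont m) (hO m)

lemma exists_dense_seq_OSet : ∃ p : ℕ → Mat n n × Mat n k × Mat n n,
    (∀ i, p i ∈ OSet Λ₁ Λ₂) ∧ OSet Λ₁ Λ₂ ⊆ closure (range p) := by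
  have hsc : ∀ r s : ℕ, SecondCountableTopology (Mat r s) := fun r s =>
    inferInstanceAs (SecondCountableTopology (Fin r → Fin s → ℝ))
  obtain ⟨S, hS, hc, hd⟩ := (TopologicalSpace.IsSeparable.of_separableSpace
    (OSet Λ₁ Λ₂)).exists_countable_dense_subset
  have hne : S.Nonempty := by
    rw [← closure_nonempty_iff]
    exact ⟨0, hd (zero_mem_OSet Λ₁ Λ₂)⟩
  obtain ⟨p, rfl⟩ := hc.exists_eq_range hne
  exact ⟨p, fun i => hS (mem_range_self i), hd⟩

/-- If `⟨μ, Ξ⟩ ≤ c` for the continuous fields with values in the constraint set, then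
`∫ J_Λ (dμ/dν) dν ≤ c`. -/
lemma lintegral_J_le (h₁ : Λ₁.IsSymm) (h₂ : Λ₂.IsSymm) {μ : Triple α n k} {ν : Measure α}
    (hν : IsReference μ ν) {c : ℝ}
    (hc : ∀ Ξ : α → Mat n n × Mat n k × Mat n n, Continuous Ξ → (∀ x, Ξ x ∈ OSet Λ₁ Λ₂) →
      pairing3 μ Ξ ≤ c) :
    ∫⁻ x, J Λ₁ Λ₂ (density μ.G ν x) (density μ.q ν x) (density μ.R ν x) ∂ν
      ≤ ENNReal.ofReal c := by
  have := hν.1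
  obtain ⟨p, hp, hdense⟩ := exists_dense_seq_OSet Λ₁ Λ₂
  -- the maxima over the first points of a dense sequence, and over `0`
  obtain ⟨u, hu0, hus⟩ : ∃ u : ℕ → α → ℝ, (u 0 = fun _ => 0) ∧
      ∀ N, u (N + 1) = fun x => max (u N x) (inner3 (density3 μ ν x) (p N)) :=
    ⟨fun N => Nat.rec (fun _ => 0)
      (fun i v x => max (v x) (inner3 (density3 μ ν x) (p i))) N, rfl, fun _ => rfl⟩
  have hum : ∀ N, Measurable (u N) := by
    intro N
    induction N with
    | zero => rw [hu0]; exact measurable_const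
    | succ N ih => rw [hus]; exact ih.max (measurable_inner3_density μ ν _)
  have hul : ∀ N, IsActionLimit Λ₁ Λ₂ μ ν (u N) := by
    intro N
    induction N with
    | zero =>
      refine ⟨fun _ _ => 0, fun _ => 0, fun _ => continuous_const,
        fun _ _ => zero_mem_OSet Λ₁ Λ₂, integrable_zero _ _ _, fun _ x => ?_, ?_⟩
      · simp [inner3_zero_right]
      · exact Filter.Eventually.of_forall fun x => by simp [inner3_zero_right, hu0]
    | succ N ih => rw [hus]; exact ih.max h₁ h₂ (hum N) (hp N)
  have hmono : ∀ x, Monotone fun N => u N x := fun x =>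
    monotone_nat_of_le_succ fun N => by rw [hus]; exact le_max_left _ _
  have hnn : ∀ N x, 0 ≤ u N x := fun N x => by
    have := hmono x (Nat.zero_le N)
    simpa [hu0] using this
  have hJ : ∀ x, J Λ₁ Λ₂ (density μ.G ν x) (density μ.q ν x) (density μ.R ν x) ≤
      ⨆ N, ENNReal.ofReal (u N x) := by
    intro x
    refine iSup₂_le fun q hq => ?_
    have hcl : IsClosed {q | ENNReal.ofReal (inner3 (density3 μ ν x) q) ≤
        ⨆ N, ENNReal.ofReal (u N x)} :=
      isClosed_le (ENNReal.continuous_ofReal.comp (continuous_inner3_right _)) continuous_const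
    have hi : ∀ i, ENNReal.ofReal (inner3 (density3 μ ν x) (p i)) ≤
        ⨆ N, ENNReal.ofReal (u N x) := fun i => by
      refine le_iSup_of_le (i + 1) (ENNReal.ofReal_le_ofReal ?_)
      rw [hus]
      exact le_max_right _ _
    exact (hcl.closure_subset_iff.2 (range_subset_iff.2 hi)) (hdense hq)
  refine (lintegral_mono hJ).trans ?_
  have hsup : ∫⁻ x, ⨆ N, ENNReal.ofReal (u N x) ∂ν = ⨆ N, ∫⁻ x, ENNReal.ofReal (u N x) ∂ν :=
    lintegral_iSup (fun N => (hum N).ennreal_ofReal)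
      fun a b hab x => ENNReal.ofReal_le_ofReal (hmono x hab)
  rw [hsup]
  refine iSup_le fun N => ?_
  obtain ⟨hi, hle⟩ := (hul N).integral_le hν hc
  rw [← ofReal_integral_eq_lintegral_ofReal hi (Filter.Eventually.of_forall (hnn N))]
  exact ENNReal.ofReal_le_ofReal hle

/-- `⟨μ, Ξ⟩ ≤ ∫ J_Λ (dμ/dν) dν` for every continuous `Ξ` with values in the constraint set. -/
lemma ofReal_pairing3_le_lintegral_J {μ : Triple α n k} {ν : Measure α} (hν : IsReference μ ν)
    {Ξ : α → Mat n n × Mat n k × Mat n n} (hΞ : Continuous Ξ) (hO : ∀ x, Ξ x ∈ OSet Λ₁ Λ₂) :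
    ENNReal.ofReal (pairing3 μ Ξ) ≤
      ∫⁻ x, J Λ₁ Λ₂ (density μ.G ν x) (density μ.q ν x) (density μ.R ν x) ∂ν := by
  rw [pairing3_eq_integral hν hΞ]
  refine (ofReal_integral_le_lintegral (integrable_inner3_density μ ν hΞ)).trans
    (lintegral_mono fun x => ?_)
  exact le_iSup₂_of_le (Ξ x) (hO x) le_rfl

/-- The value of the action does not depend on the reference measure. -/
lemma lintegral_J_eq_action (h₁ : Λ₁.IsSymm) (h₂ : Λ₂.IsSymm) {μ : Triple α n k} {ν : Measure α}
    (hν : IsReference μ ν) :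
    ∫⁻ x, J Λ₁ Λ₂ (density μ.G ν x) (density μ.q ν x) (density μ.R ν x) ∂ν = action Λ₁ Λ₂ μ := by
  have key : ∀ ν₁ ν₂ : Measure α, IsReference μ ν₁ → IsReference μ ν₂ →
      ∫⁻ x, J Λ₁ Λ₂ (density μ.G ν₁ x) (density μ.q ν₁ x) (density μ.R ν₁ x) ∂ν₁ ≤
      ∫⁻ x, J Λ₁ Λ₂ (density μ.G ν₂ x) (density μ.q ν₂ x) (density μ.R ν₂ x) ∂ν₂ := by
    intro ν₁ ν₂ hν₁ hν₂
    by_cases htop : ∫⁻ x, J Λ₁ Λ₂ (density μ.G ν₂ x) (density μ.q ν₂ x) (density μ.R ν₂ x) ∂ν₂ = ⊤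
    · rw [htop]; exact le_top
    · refine (lintegral_J_le Λ₁ Λ₂ h₁ h₂ hν₁ fun Ξ hΞ hO => ?_).trans
        (ENNReal.ofReal_toReal htop).le
      exact (ENNReal.ofReal_le_iff_le_toReal htop).1
        (ofReal_pairing3_le_lintegral_J Λ₁ Λ₂ hν₂ hΞ hO)
  exact le_antisymm (key _ _ hν (isReference_refMeasure μ)) (key _ _ (isReference_refMeasure μ) hν)

lemma action_le (h₁ : Λ₁.IsSymm) (h₂ : Λ₂.IsSymm) {μ : Triple α n k} {c : ℝ}
    (hc : ∀ Ξ : α → Mat n n × Mat n k × Mat n n, Continuous Ξ → (∀ x, Ξ x ∈ OSet Λ₁ Λ₂) →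
      pairing3 μ Ξ ≤ c) : action Λ₁ Λ₂ μ ≤ ENNReal.ofReal c :=
  lintegral_J_le Λ₁ Λ₂ h₁ h₂ (isReference_refMeasure μ) hc

lemma ofReal_pairing3_le_action {μ : Triple α n k}
    {Ξ : α → Mat n n × Mat n k × Mat n n} (hΞ : Continuous Ξ) (hO : ∀ x, Ξ x ∈ OSet Λ₁ Λ₂) :
    ENNReal.ofReal (pairing3 μ Ξ) ≤ action Λ₁ Λ₂ μ :=
  ofReal_pairing3_le_lintegral_J Λ₁ Λ₂ (isReference_refMeasure μ) hΞ hO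

lemma pairing3_le_action {μ : Triple α n k}
    {Ξ : α → Mat n n × Mat n k × Mat n n} (hΞ : Continuous Ξ) (hO : ∀ x, Ξ x ∈ OSet Λ₁ Λ₂) :
    ((pairing3 μ Ξ : ℝ) : EReal) ≤ (action Λ₁ Λ₂ μ : EReal) := by
  refine le_trans ?_ (EReal.coe_ennreal_le_coe_ennreal_iff.2
    (ofReal_pairing3_le_action Λ₁ Λ₂ hΞ hO))
  rw [EReal.coe_ennreal_ofReal]
  exact EReal.coe_le_coe_iff.2 (le_max_left _ _)

end Action

/-! ### Representation of bounded functionals by signed measures -/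

section Riesz

variable {α : Type*} [MetricSpace α]

/-- The positive part `φ ↦ sup {F ψ : 0 ≤ ψ ≤ φ}` of a functional on `C(α)`, for `φ ≥ 0`. -/
noncomputable def posPartFun (F : C(α, ℝ) →ₗ[ℝ] ℝ) (φ : C(α, ℝ)) : ℝ :=
  sSup (F '' Icc 0 φ)

section PosPart

variable {F : C(α, ℝ) →ₗ[ℝ] ℝ} {K : ℝ}

lemma posPartFun_le {φ : C(α, ℝ)} (hφ : 0 ≤ φ)
    {c : ℝ}
    (h : ∀ ψ, 0 ≤ ψ → ψ ≤ φ → F ψ ≤ c) : posPartFun F φ ≤ c := by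
  refine csSup_le ⟨_, 0, ⟨le_rfl, hφ⟩, rfl⟩ ?_
  rintro _ ⟨ψ, ⟨h0, h1⟩, rfl⟩
  exact h ψ h0 h1

variable [CompactSpace α]

lemma bddAbove_image_Icc (hF : ∀ φ, |F φ| ≤ K * ‖φ‖) (φ : C(α, ℝ)) :
    BddAbove (F '' Icc 0 φ) := by
  refine ⟨|K| * ‖φ‖, ?_⟩
  rintro _ ⟨ψ, ⟨h0, h1⟩, rfl⟩
  have hn : ‖ψ‖ ≤ ‖φ‖ := by
    refine (ContinuousMap.norm_le _ (norm_nonneg _)).2 fun x => ?_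
    have hx : 0 ≤ ψ x := h0 x
    have hx' : ψ x ≤ φ x := h1 x
    rw [Real.norm_of_nonneg hx]
    exact hx'.trans ((le_abs_self _).trans (φ.norm_coe_le_norm x))
  calc F ψ ≤ |F ψ| := le_abs_self _
    _ ≤ K * ‖ψ‖ := hF ψ
    _ ≤ |K| * ‖φ‖ := mul_le_mul (le_abs_self K) hn (norm_nonneg _) (abs_nonneg _)

lemma le_posPartFun (hF : ∀ φ, |F φ| ≤ K * ‖φ‖) {φ ψ : C(α, ℝ)} (h0 : 0 ≤ ψ) (h1 : ψ ≤ φ) :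
    F ψ ≤ posPartFun F φ :=
  le_csSup (bddAbove_image_Icc hF φ) ⟨ψ, ⟨h0, h1⟩, rfl⟩

lemma posPartFun_nonneg (hF : ∀ φ, |F φ| ≤ K * ‖φ‖) {φ : C(α, ℝ)} (hφ : 0 ≤ φ) :
    0 ≤ posPartFun F φ := by
  simpa using le_posPartFun hF le_rfl hφ

lemma posPartFun_add (hF : ∀ φ, |F φ| ≤ K * ‖φ‖) {φ χ : C(α, ℝ)} (hφ : 0 ≤ φ) (hχ : 0 ≤ χ) :
    posPartFun F (φ + χ) = posPartFun F φ + posPartFun F χ := by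
  refine le_antisymm (posPartFun_le (add_nonneg hφ hχ) fun ψ h0 h1 => ?_) ?_
  · -- Riesz decomposition of `ψ ≤ φ + χ`
    have e : ψ = ψ ⊓ φ + (ψ - ψ ⊓ φ) := by abel
    rw [e, map_add]
    refine add_le_add (le_posPartFun hF (le_inf h0 hφ) inf_le_right)
      (le_posPartFun hF (sub_nonneg.2 inf_le_left) fun x => ?_)
    have h2 : ψ x ≤ φ x + χ x := h1 x
    have h3 : 0 ≤ χ x := hχ x
    change ψ x - min (ψ x) (φ x) ≤ χ x
    rcases min_choice (ψ x) (φ x) with h | h <;> rw [h] <;> linarith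
  · rw [← le_sub_iff_add_le]
    refine posPartFun_le hφ fun ψ h0 h1 => ?_
    rw [le_sub_comm]
    refine posPartFun_le hχ fun ψ' h0' h1' => ?_
    rw [le_sub_iff_add_le, ← map_add, add_comm]
    exact le_posPartFun hF (add_nonneg h0 h0') (add_le_add h1 h1')

lemma posPartFun_smul_le (hF : ∀ φ, |F φ| ≤ K * ‖φ‖) {φ : C(α, ℝ)} (hφ : 0 ≤ φ)
    {c : ℝ} (hc : 0 < c) :
    posPartFun F (c • φ) ≤ c * posPartFun F φ := by
  refine posPartFun_le (smul_nonneg hc.le hφ) fun ψ h0 h1 => ?_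
  have h2 : F (c⁻¹ • ψ) ≤ posPartFun F φ := by
    refine le_posPartFun hF (smul_nonneg (inv_pos.2 hc).le h0) fun x => ?_
    have h2 : ψ x ≤ c * φ x := h1 x
    change c⁻¹ * ψ x ≤ φ x
    rwa [inv_mul_le_iff₀ hc]
  rw [map_smul, smul_eq_mul, inv_mul_le_iff₀ hc] at h2
  exact h2

lemma posPartFun_smul (hF : ∀ φ, |F φ| ≤ K * ‖φ‖) {φ : C(α, ℝ)} (hφ : 0 ≤ φ)
    {c : ℝ} (hc : 0 ≤ c) :
    posPartFun F (c • φ) = c * posPartFun F φ := by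
  rcases hc.eq_or_lt with rfl | hc
  · rw [zero_smul, zero_mul]
    refine le_antisymm (posPartFun_le le_rfl fun ψ h0 h1 => ?_) (posPartFun_nonneg hF le_rfl)
    rw [le_antisymm h1 h0, map_zero]
  · refine le_antisymm (posPartFun_smul_le hF hφ hc) ?_
    have := posPartFun_smul_le hF (smul_nonneg hc.le hφ) (inv_pos.2 hc)
    rwa [smul_smul, inv_mul_cancel₀ hc.ne', one_smul, ← div_eq_inv_mul, le_div_iff₀' hc] at this

end PosPart

variable [CompactSpace α] [MeasurableSpace α] [BorelSpace α]

/-- A nonnegative, additive and positively homogeneous function on the cone of nonnegative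
continuous functions is the integral against a finite measure. -/
lemma exists_measure_of_cone_functional (P : C(α, ℝ) → ℝ) (hP : ∀ φ, 0 ≤ φ → 0 ≤ P φ)
    (hadd : ∀ φ χ, 0 ≤ φ → 0 ≤ χ → P (φ + χ) = P φ + P χ)
    (hsmul : ∀ (c : ℝ) φ, 0 ≤ c → 0 ≤ φ → P (c • φ) = c * P φ) :
    ∃ μ : Measure α, IsFiniteMeasure μ ∧ ∀ φ : C(α, ℝ), 0 ≤ φ → ∫ x, φ x ∂μ = P φ := by
  let T : CompactlySupportedContinuousMap α NNReal → C(α, ℝ) := fun f =>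
    ⟨fun x => (f x : ℝ), NNReal.continuous_coe.comp f.continuous⟩
  have hT : ∀ f, 0 ≤ T f := fun f x => (f x).2
  let Λ : CompactlySupportedContinuousMap α NNReal →ₗ[NNReal] NNReal :=
    { toFun := fun f => ⟨P (T f), hP _ (hT f)⟩
      map_add' := fun f g => by
        refine NNReal.eq ?_
        change P (T (f + g)) = P (T f) + P (T g)
        rw [← hadd _ _ (hT f) (hT g)]
        congr 1
      map_smul' := fun c f => by
        refine NNReal.eq ?_
        change P (T (c • f)) = (c : ℝ) * P (T f)
        rw [← hsmul (c : ℝ) _ c.2 (hT f)]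
        congr 1 }
  refine ⟨NNRealRMK.rieszMeasure Λ, ⟨isCompact_univ.measure_lt_top⟩, fun φ hφ => ?_⟩
  let f : CompactlySupportedContinuousMap α NNReal :=
    ⟨⟨fun x => ⟨φ x, hφ x⟩, φ.continuous.subtype_mk _⟩,
      HasCompactSupport.of_compactSpace _⟩
  exact NNRealRMK.integral_rieszMeasure Λ f

/-- The Riesz–Markov–Kakutani theorem for bounded functionals on `C(α)`. -/
theorem exists_signedMeasure_of_bounded (F : C(α, ℝ) →ₗ[ℝ] ℝ) {K : ℝ}
    (hF : ∀ φ, |F φ| ≤ K * ‖φ‖) : ∃ σ : SignedMeasure α, ∀ φ : C(α, ℝ),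
      VectorMeasure.integral σ φ (ContinuousLinearMap.lsmul ℝ ℝ).flip = F φ := by
  obtain ⟨μ, hμ, hμP⟩ := exists_measure_of_cone_functional (posPartFun F)
    (fun φ h => posPartFun_nonneg hF h) (fun φ χ h h' => posPartFun_add hF h h')
    (fun c φ hc h => posPartFun_smul hF h hc)
  obtain ⟨ν, hν, hνP⟩ := exists_measure_of_cone_functional (fun φ => posPartFun F φ - F φ)
    (fun φ h => sub_nonneg.2 (le_posPartFun hF h le_rfl))
    (fun φ χ h h' => by rw [posPartFun_add hF h h', map_add]; ring)
    (fun c φ hc h => by rw [posPartFun_smul hF h hc, map_smul, smul_eq_mul]; ring)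
  have hint : ∀ (τ : Measure α) [IsFiniteMeasure τ] (φ : C(α, ℝ)), Integrable φ τ :=
    fun τ _ φ => Integrable.of_bound φ.continuous.measurable.aestronglyMeasurable ‖φ‖
      (Filter.Eventually.of_forall φ.norm_coe_le_norm)
  have hpos : ∀ φ : C(α, ℝ), 0 ≤ φ → ∫ x, φ x ∂μ - ∫ x, φ x ∂ν = F φ := fun φ h => by
    rw [hμP φ h, hνP φ h]; ring
  refine ⟨μ.toSignedMeasure - ν.toSignedMeasure, fun φ => ?_⟩
  rw [VectorMeasure.integral_sub_vectorMeasure, VectorMeasure.integral_toSignedMeasure,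
    VectorMeasure.integral_toSignedMeasure]
  · have h1 := hpos (φ ⊔ 0) le_sup_right
    have h2 := hpos (-φ ⊔ 0) le_sup_right
    have e : φ = φ ⊔ 0 - (-φ ⊔ 0) := by
      ext x
      simp only [ContinuousMap.sub_apply, ContinuousMap.sup_apply, ContinuousMap.neg_apply,
        ContinuousMap.zero_apply]
      exact (max_zero_sub_eq_self (φ x)).symm
    have e3 : ∀ τ : Measure α, IsFiniteMeasure τ →
        ∫ x, φ x ∂τ = ∫ x, (φ ⊔ 0) x ∂τ - ∫ x, (-φ ⊔ 0) x ∂τ := fun τ _ => by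
      rw [← integral_sub (hint τ _) (hint τ _)]
      conv_lhs => rw [e]
      rfl
    rw [e3 μ hμ, e3 ν hν, e, map_sub, ← e, ← h1, ← h2]
    ring
  · rw [VectorMeasure.Integrable, Measure.variation_toSignedMeasure]
    exact hint μ φ
  · rw [VectorMeasure.Integrable, Measure.variation_toSignedMeasure]
    exact hint ν φ

end Riesz

/-! ### Subgradients of the action -/

section Subgradient

variable {α : Type*} [MeasurableSpace α] {r s n k : ℕ}

instance : Zero (Triple α n k) := ⟨⟨0, 0, 0, fun _ => Matrix.transpose_zero⟩⟩

lemma pairing_zero_measure (F : α → Mat r s) :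
    pairing (0 : VectorMeasure α (Mat r s)) F = 0 := by
  have h : ∀ i j, entry (0 : VectorMeasure α (Mat r s)) i j = 0 := fun i j => by
    ext A _
    rfl
  simp [pairing, h]

@[simp] lemma pairing3_zero (Ξ : α → Mat n n × Mat n k × Mat n n) :
    pairing3 (0 : Triple α n k) Ξ = 0 := by
  change pairing 0 _ + pairing 0 _ + pairing 0 _ = 0
  simp [pairing_zero_measure]

lemma pairing_dirac [MeasurableSingletonClass α] (z : α) (X : Mat r s) (F : α → Mat r s) :
    pairing (VectorMeasure.dirac z X) F = frob X (F z) := by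
  have h : ∀ i j, entry (VectorMeasure.dirac z X) i j = VectorMeasure.dirac z (X i j) :=
    fun i j => by
      ext A hA
      by_cases hz : z ∈ A <;> simp [hA, hz]
  simp [pairing, h, frob_eq_sum, VectorMeasure.integral_dirac]

/-- The measure `δ_z (X, Y, Z)`. -/
noncomputable def diracTriple (z : α) (D : Mat n n × Mat n k × Mat n n) (hD : D.1.IsSymm) :
    Triple α n k where
  G := VectorMeasure.dirac z D.1
  q := VectorMeasure.dirac z D.2.1
  R := VectorMeasure.dirac z D.2.2
  symm := fun A => by
    by_cases hA : MeasurableSet A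
    · by_cases hz : z ∈ A
      · simpa [hA, hz] using hD
      · simp [hA, hz]
    · rw [VectorMeasure.not_measurable _ hA]
      exact Matrix.transpose_zero

lemma pairing3_diracTriple [MeasurableSingletonClass α] (z : α)
    (D : Mat n n × Mat n k × Mat n n) (hD : D.1.IsSymm)
    (Ξ : α → Mat n n × Mat n k × Mat n n) :
    pairing3 (diracTriple z D hD) Ξ = inner3 D (Ξ z) := by
  simp [pairing3, diracTriple, pairing_dirac, inner3]

end Subgradient

section Optimality

variable {α : Type*} [MetricSpace α] [CompactSpace α] [MeasurableSpace α] [BorelSpace α]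
  {n k : ℕ} {Λ₁ : Mat k k} {Λ₂ : Mat n n}

lemma action_zero (h₁ : Λ₁.IsSymm) (h₂ : Λ₂.IsSymm) :
    action Λ₁ Λ₂ (0 : Triple α n k) = 0 := by
  have := action_le (α := α) Λ₁ Λ₂ h₁ h₂ (μ := 0) (c := 0) fun Ξ _ _ => by simp
  simpa using this

/-- Testing the subgradient inequality with `δ_z v vᵀ (1, B Λ₁², C Λ₂²)` shows that a subgradient
takes its values in the constraint set. -/
lemma IsSubgradient.mem_OSet (h₁ : Λ₁.IsSymm) (h₂ : Λ₂.IsSymm) {μ : Triple α n k}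
    {Ξ : α → Mat n n × Mat n k × Mat n n} (hsymm : ∀ z, (Ξ z).1.IsSymm)
    (hμ : IsSubgradient Λ₁ Λ₂ μ Ξ) (htop : action Λ₁ Λ₂ μ ≠ ⊤) (z : α) : Ξ z ∈ OSet Λ₁ Λ₂ := by
  have key : ∀ v : Fin n → ℝ, v ⬝ᵥ hjExpr Λ₁ Λ₂ (Ξ z) *ᵥ v ≤
      pairing3 μ Ξ - (action Λ₁ Λ₂ μ).toReal := by
    intro v
    have hX := posSemidef_vecMulVec v
    have hXs := ((posSemidef_iff_real _).1 hX).1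
    set X := vecMulVec v v with hXdef
    set D : Mat n n × Mat n k × Mat n n :=
      (X, X * (Ξ z).2.1 * Λ₁ ^ 2, X * (Ξ z).2.2 * Λ₂ ^ 2) with hD
    set c := 1 / 2 * frob X ((Ξ z).2.1 * Λ₁ ^ 2 * (Ξ z).2.1ᵀ)
      + 1 / 2 * frob X ((Ξ z).2.2 * Λ₂ ^ 2 * (Ξ z).2.2ᵀ) with hc
    have hc0 : 0 ≤ c := by
      have a := frob_nonneg_of_posSemidef hX (posSemidef_mul_sq_mul Λ₁ h₁ (Ξ z).2.1)
      have b := frob_nonneg_of_posSemidef hX (posSemidef_mul_sq_mul Λ₂ h₂ (Ξ z).2.2)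
      positivity
    have hact : action Λ₁ Λ₂ (diracTriple z D hXs) ≤ ENNReal.ofReal c :=
      action_le Λ₁ Λ₂ h₁ h₂ fun Ξ' _ hO => by
        rw [pairing3_diracTriple]
        exact inner3_le_of_mem_OSet Λ₁ Λ₂ h₁ h₂ X hX _ _ (hO z)
    have hsub := (hμ (diracTriple z D hXs)).trans (EReal.coe_ennreal_le_coe_ennreal_iff.2 hact)
    rw [EReal.coe_ennreal_ofReal, max_eq_left hc0, ← EReal.coe_ennreal_toReal htop,
      ← EReal.coe_add, EReal.coe_le_coe_iff, pairing3_diracTriple] at hsub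
    have hval : inner3 D (Ξ z) = v ⬝ᵥ hjExpr Λ₁ Λ₂ (Ξ z) *ᵥ v + c := by
      rw [← frob_vecMulVec, ← hXdef, frob_hjExpr]
      simp only [inner3, hD, hc, frob_mul_sq_mul X hXs Λ₁ h₁, frob_mul_sq_mul X hXs Λ₂ h₂]
      ring
    linarith
  refine (mem_OSet_iff Λ₁ Λ₂ h₁ h₂ _).2 ⟨hsymm z, fun v => ?_⟩
  -- a quadratic form that is bounded above is nonpositive: rescale `v`
  by_contra! hlt
  set w := v ⬝ᵥ hjExpr Λ₁ Λ₂ (Ξ z) *ᵥ v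
  set e := pairing3 μ Ξ - (action Λ₁ Λ₂ μ).toReal
  have h := key (((|e| + w) / w) • v)
  have e1 : (((|e| + w) / w) • v) ⬝ᵥ hjExpr Λ₁ Λ₂ (Ξ z) *ᵥ (((|e| + w) / w) • v) =
      ((|e| + w) / w) * (|e| + w) := by
    rw [mulVec_smul, smul_dotProduct, dotProduct_smul, smul_eq_mul, smul_eq_mul]
    rw [show v ⬝ᵥ hjExpr Λ₁ Λ₂ (Ξ z) *ᵥ v = w from rfl, div_mul_cancel₀ _ hlt.ne']
  rw [e1] at h
  have h2 : 1 ≤ (|e| + w) / w := by rw [le_div_iff₀ hlt]; linarith [abs_nonneg e]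
  nlinarith [le_abs_self e, abs_nonneg e]

/-- `Ξ ∈ ∂𝒥_Λ(μ)` if and only if `Ξ` takes values in the constraint set and `𝒥_Λ(μ) = ⟨μ, Ξ⟩`. -/
lemma isSubgradient_iff (h₁ : Λ₁.IsSymm) (h₂ : Λ₂.IsSymm) {μ : Triple α n k}
    {Ξ : α → Mat n n × Mat n k × Mat n n} (hΞ : Continuous Ξ) (hsymm : ∀ z, (Ξ z).1.IsSymm) :
    IsSubgradient Λ₁ Λ₂ μ Ξ ↔
      (∀ z, Ξ z ∈ OSet Λ₁ Λ₂) ∧ (action Λ₁ Λ₂ μ : EReal) = ((pairing3 μ Ξ : ℝ) : EReal) := by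
  constructor
  · intro h
    have h0 := h 0
    rw [action_zero h₁ h₂, pairing3_zero, zero_sub, EReal.coe_ennreal_zero] at h0
    have htop : action Λ₁ Λ₂ μ ≠ ⊤ := by
      intro ht
      rw [ht, EReal.coe_ennreal_top, EReal.top_add_coe] at h0
      exact absurd h0 (by simp)
    have hO := h.mem_OSet h₁ h₂ hsymm htop
    refine ⟨hO, le_antisymm ?_ (pairing3_le_action Λ₁ Λ₂ hΞ hO)⟩
    rw [← EReal.coe_ennreal_toReal htop, ← EReal.coe_add, ← EReal.coe_zero,
      EReal.coe_le_coe_iff] at h0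
    rw [← EReal.coe_ennreal_toReal htop, EReal.coe_le_coe_iff]
    linarith
  · rintro ⟨hO, heq⟩ ν
    rw [heq, ← EReal.coe_add, add_sub_cancel]
    exact pairing3_le_action Λ₁ Λ₂ hΞ hO

/-- `𝒥_Λ(μ) = ⟨μ, Ξ⟩` if and only if `Ξ` exposes the density of `μ` almost everywhere. -/
lemma action_eq_pairing3_iff_ae (h₁ : Λ₁.IsSymm) (h₂ : Λ₂.IsSymm) {μ : Triple α n k}
    {ν : Measure α} (hν : IsReference μ ν)
    {Ξ : α → Mat n n × Mat n k × Mat n n} (hΞ : Continuous Ξ) (hO : ∀ z, Ξ z ∈ OSet Λ₁ Λ₂) :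
    (action Λ₁ Λ₂ μ : EReal) = ((pairing3 μ Ξ : ℝ) : EReal) ↔
      ∀ᵐ z ∂ν, ∀ p ∈ OSet Λ₁ Λ₂, inner3 (density3 μ ν z) p ≤ inner3 (density3 μ ν z) (Ξ z) := by
  have := hν.1
  have hint := integrable_inner3_density μ ν hΞ
  constructor
  · intro heq
    have hnn : 0 ≤ pairing3 μ Ξ := by
      rw [← EReal.coe_nonneg, ← heq]
      exact EReal.coe_ennreal_nonneg _
    have hact : action Λ₁ Λ₂ μ = ENNReal.ofReal (pairing3 μ Ξ) := by
      rw [← EReal.coe_ennreal_eq_coe_ennreal_iff, heq, EReal.coe_ennreal_ofReal, max_eq_left hnn]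
    obtain ⟨p, hp, hdense⟩ := exists_dense_seq_OSet Λ₁ Λ₂
    have hone : ∀ q ∈ OSet Λ₁ Λ₂,
        ∀ᵐ z ∂ν, inner3 (density3 μ ν z) q ≤ inner3 (density3 μ ν z) (Ξ z) := by
      intro q hq
      have hqi := integrable_inner3_density μ ν (continuous_const (y := q))
      have hmi : Integrable (fun z => max (inner3 (density3 μ ν z) (Ξ z))
          (inner3 (density3 μ ν z) q)) ν := hint.sup hqi
      have hle : ∫ z, max (inner3 (density3 μ ν z) (Ξ z)) (inner3 (density3 μ ν z) q) ∂ν ≤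
          ∫ z, inner3 (density3 μ ν z) (Ξ z) ∂ν := by
        rw [← pairing3_eq_integral hν hΞ, ← ENNReal.ofReal_le_ofReal_iff hnn, ← hact,
          ← lintegral_J_eq_action Λ₁ Λ₂ h₁ h₂ hν]
        refine (ofReal_integral_le_lintegral hmi).trans (lintegral_mono fun z => ?_)
        rcases max_choice (inner3 (density3 μ ν z) (Ξ z)) (inner3 (density3 μ ν z) q) with h | h
        · simp only [h]
          exact le_iSup₂_of_le (Ξ z) (hO z) le_rfl
        · simp only [h]
          exact le_iSup₂_of_le q hq le_rfl
      have hz : ∫ z, (max (inner3 (density3 μ ν z) (Ξ z)) (inner3 (density3 μ ν z) q)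
          - inner3 (density3 μ ν z) (Ξ z)) ∂ν = 0 := by
        refine le_antisymm ?_ (integral_nonneg fun z => sub_nonneg.2 (le_max_left _ _))
        rw [integral_sub hmi hint]
        linarith
      have hae := (integral_eq_zero_iff_of_nonneg
        (fun z => sub_nonneg.2 (le_max_left _ _)) (hmi.sub hint)).1 hz
      filter_upwards [hae] with z hz
      have hz' : max (inner3 (density3 μ ν z) (Ξ z)) (inner3 (density3 μ ν z) q)
          - inner3 (density3 μ ν z) (Ξ z) = 0 := hz
      have := le_max_right (inner3 (density3 μ ν z) (Ξ z)) (inner3 (density3 μ ν z) q)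
      linarith
    filter_upwards [ae_all_iff.2 fun i => hone (p i) (hp i)] with z hz q hq
    have hcl : IsClosed {q | inner3 (density3 μ ν z) q ≤ inner3 (density3 μ ν z) (Ξ z)} :=
      isClosed_le (continuous_inner3_right _) continuous_const
    exact (hcl.closure_subset_iff.2 (range_subset_iff.2 hz)) (hdense hq)
  · intro hae
    refine le_antisymm ?_ (pairing3_le_action Λ₁ Λ₂ hΞ hO)
    have hpos : 0 ≤ᵐ[ν] fun z => inner3 (density3 μ ν z) (Ξ z) := by
      filter_upwards [hae] with z hz
      simpa [inner3_zero_right] using hz 0 (zero_mem_OSet Λ₁ Λ₂)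
    have hnn : 0 ≤ pairing3 μ Ξ := by
      rw [pairing3_eq_integral hν hΞ]
      exact integral_nonneg_of_ae hpos
    have hle : action Λ₁ Λ₂ μ ≤ ENNReal.ofReal (pairing3 μ Ξ) := by
      rw [← lintegral_J_eq_action Λ₁ Λ₂ h₁ h₂ hν, pairing3_eq_integral hν hΞ,
        ofReal_integral_eq_lintegral_ofReal hint hpos]
      refine lintegral_mono_ae ?_
      filter_upwards [hae] with z hz
      exact iSup₂_le fun q hq => ENNReal.ofReal_le_ofReal (hz q hq)
    refine (EReal.coe_ennreal_le_coe_ennreal_iff.2 hle).trans (le_of_eq ?_)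
    rw [EReal.coe_ennreal_ofReal, max_eq_left hnn]

/-- `𝒥_Λ(μ) = ⟨μ, Ξ⟩` in terms of the densities of `μ`. -/
lemma action_eq_pairing3_iff (h₁ : Λ₁.IsSymm) (h₂ : Λ₂.IsSymm) {μ : Triple α n k}
    {ν : Measure α} (hν : IsReference μ ν)
    {Ξ : α → Mat n n × Mat n k × Mat n n} (hΞ : Continuous Ξ) (hO : ∀ z, Ξ z ∈ OSet Λ₁ Λ₂) :
    (action Λ₁ Λ₂ μ : EReal) = ((pairing3 μ Ξ : ℝ) : EReal) ↔
      IsPSDValued μ.G ∧ ∀ᵐ z ∂ν,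
        density μ.q ν z = density μ.G ν z * (Ξ z).2.1 * Λ₁ ^ 2 ∧
        density μ.R ν z = density μ.G ν z * (Ξ z).2.2 * Λ₂ ^ 2 ∧
        frob (density μ.G ν z) (hjExpr Λ₁ Λ₂ (Ξ z)) = 0 := by
  have := hν.1
  rw [action_eq_pairing3_iff_ae h₁ h₂ hν hΞ hO, isPSDValued_iff_ae μ.symm hν.2.1,
    ← Filter.eventually_and]
  refine Filter.eventually_congr (Filter.Eventually.of_forall fun z => ?_)
  exact forall_inner3_le_iff Λ₁ Λ₂ h₁ h₂ _ (isSymm_density3 μ ν z) (hO z)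

end Optimality

/-! ### Existence of measures by Hahn–Banach -/

section Entries

variable {α : Type*} [MeasurableSpace α] {r s : ℕ}

/-- The matrix-valued measure with given entries. -/
noncomputable def ofEntries (σ : Fin r → Fin s → SignedMeasure α) :
    VectorMeasure α (Mat r s) where
  measureOf' A := Matrix.of fun i j => σ i j A
  empty' := by ext; simp
  not_measurable' A hA := by ext; simp [VectorMeasure.not_measurable _ hA]
  m_iUnion' f hf hd := by
    refine Pi.hasSum.2 fun i => Pi.hasSum.2 fun j => ?_
    exact (σ i j).m_iUnion hf hd

@[simp] lemma ofEntries_apply (σ : Fin r → Fin s → SignedMeasure α) (A : Set α) (i : Fin r)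
    (j : Fin s) : ofEntries σ A i j = σ i j A := rfl

@[simp] lemma entry_ofEntries (σ : Fin r → Fin s → SignedMeasure α) (i : Fin r) (j : Fin s) :
    entry (ofEntries σ) i j = σ i j := by
  ext A _
  rfl

end Entries

lemma abs_dotProduct_mulVec_le {r : ℕ} (A : Mat r r) (v : Fin r → ℝ) :
    |v ⬝ᵥ A *ᵥ v| ≤ (∑ i, ∑ j, |A i j|) * (v ⬝ᵥ v) := by
  set N := v ⬝ᵥ v with hN
  simp only [Finset.sum_mul]
  simp only [dotProduct, mulVec, Finset.mul_sum]
  refine (Finset.abs_sum_le_sum_abs _ _).trans (Finset.sum_le_sum fun i _ => ?_)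
  refine (Finset.abs_sum_le_sum_abs _ _).trans ?_
  refine Finset.sum_le_sum fun j _ => ?_
  rw [abs_mul, abs_mul]
  have h : |v i| * |v j| ≤ N := by
    have hi : |v i| * |v i| ≤ N := by
      rw [abs_mul_abs_self]
      exact Finset.single_le_sum (fun l _ => mul_self_nonneg (v l)) (Finset.mem_univ i)
    have hj : |v j| * |v j| ≤ N := by
      rw [abs_mul_abs_self]
      exact Finset.single_le_sum (fun l _ => mul_self_nonneg (v l)) (Finset.mem_univ j)
    nlinarith [mul_self_nonneg (|v i| - |v j|)]
  calc |v i| * (|A i j| * |v j|) = |A i j| * (|v i| * |v j|) := by ring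
    _ ≤ |A i j| * N := mul_le_mul_of_nonneg_left h (abs_nonneg _)

section Existence

variable {n k : ℕ} {Λ₁ : Mat k k} {Λ₂ : Mat n n}

variable (Λ₁ Λ₂) in
/-- The fields satisfying the constraint of `OSet`, without the symmetry of the first component. -/
def constraintFields (α : Type*) [TopologicalSpace α] :
    Set C(α, Mat n n × Mat n k × Mat n n) :=
  {Ξ | ∀ z v, v ⬝ᵥ hjExpr Λ₁ Λ₂ (Ξ z) *ᵥ v ≤ 0}

section Extension

variable {α : Type*} [TopologicalSpace α]

/-- Hahn–Banach for the set of fields satisfying the constraint, which has an interior point. -/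
lemma exists_extension_le_on_constraintFields (h₁ : Λ₁.IsSymm) (h₂ : Λ₂.IsSymm)
    (W : Submodule ℝ C(α, Mat n n × Mat n k × Mat n n))
    (f : C(α, Mat n n × Mat n k × Mat n n) →ₗ[ℝ] ℝ) {c : ℝ}
    (hfc : ∀ Ξ ∈ W, Ξ ∈ constraintFields Λ₁ Λ₂ α → f Ξ ≤ c)
    {w₀ : C(α, Mat n n × Mat n k × Mat n n)} (hw₀W : w₀ ∈ W)
    (hint : ∀ x, ∃ ε > 0, ∀ φ : C(α, ℝ), (∀ z, |φ z| ≤ ε) →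
      w₀ + φ • x ∈ constraintFields Λ₁ Λ₂ α) :
    ∃ F : C(α, Mat n n × Mat n k × Mat n n) →ₗ[ℝ] ℝ,
      (∀ Ξ ∈ W, F Ξ = f Ξ) ∧ ∀ Ξ ∈ constraintFields Λ₁ Λ₂ α, F Ξ ≤ c := by
  set T : Set C(α, Mat n n × Mat n k × Mat n n) :=
    {x | w₀ + x ∈ constraintFields Λ₁ Λ₂ α} with hT
  have hw₀O : w₀ ∈ constraintFields Λ₁ Λ₂ α := by
    obtain ⟨ε, hε, h⟩ := hint 0
    simpa using h 0 fun z => by simpa using hε.le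
  have hconv : Convex ℝ T := by
    intro x hx y hy a b ha hb hab z v
    have h := dotProduct_hjExpr_combo_le Λ₁ Λ₂ h₁ h₂ ((w₀ + x) z) ((w₀ + y) z) v ha hb hab
    have e : (w₀ + (a • x + b • y)) z = a • (w₀ + x) z + b • (w₀ + y) z := by
      change w₀ z + (a • x z + b • y z) = a • (w₀ z + x z) + b • (w₀ z + y z)
      obtain rfl : b = 1 - a := by linarith
      module
    rw [e]
    nlinarith [hx z v, hy z v]
  have habs : Absorbent ℝ T := by
    rw [absorbent_iff_eventually_nhdsNE_zero]
    intro x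
    obtain ⟨ε, hε, h⟩ := hint x
    refine Filter.Eventually.filter_mono nhdsWithin_le_nhds ?_
    filter_upwards [Metric.closedBall_mem_nhds (0 : ℝ) hε] with t ht
    have := h (ContinuousMap.const α t) fun z => by simpa using ht
    exact this
  have hc0 : 0 ≤ c - f w₀ := sub_nonneg.2 (hfc w₀ hw₀W hw₀O)
  obtain ⟨F, hFW, hF⟩ := exists_extension_of_le_sublinear ⟨W, f.domRestrict W⟩
    (fun x => (c - f w₀) * gauge T x)
    (fun t ht x => by rw [gauge_smul_of_nonneg ht.le, smul_eq_mul]; ring)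
    (fun x y => by
      rw [← mul_add]
      exact mul_le_mul_of_nonneg_left (gauge_add_le hconv habs x y) hc0)
    (fun x => by
      change f x ≤ (c - f w₀) * gauge T x
      have hb : ∀ b, gauge T (x : C(α, _)) < b → f x ≤ (c - f w₀) * b := by
        intro b hb
        obtain ⟨t, ht, htb, y, hy, hyx⟩ := exists_lt_of_gauge_lt habs hb
        have hyx' : t • y = (x : C(α, _)) := hyx
        have hyW : y ∈ W := by
          have : y = t⁻¹ • (x : C(α, _)) := by
            rw [← hyx', smul_smul, inv_mul_cancel₀ ht.ne', one_smul]
          rw [this]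
          exact W.smul_mem _ x.2
        have h1 := hfc _ (W.add_mem hw₀W hyW) hy
        rw [map_add] at h1
        rw [← hyx', map_smul, smul_eq_mul]
        nlinarith
      -- if `c = f w₀` the gauge plays no role, and `f ≤ 0` on `W`
      refine le_of_forall_gt_imp_ge_of_dense fun e he => ?_
      rcases hc0.eq_or_lt with h0 | h0
      · have := hb _ (lt_add_one _)
        rw [← h0] at this he
        linarith
      · have := hb (e / (c - f w₀)) (by rwa [lt_div_iff₀' h0])
        rwa [mul_div_cancel₀ _ h0.ne'] at this)
  refine ⟨F, fun Ξ hΞ => hFW ⟨Ξ, hΞ⟩, fun Ξ hΞ => ?_⟩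
  have hmem : Ξ - w₀ ∈ T := by simpa [hT] using hΞ
  have h1 := (hF (Ξ - w₀)).trans
    (mul_le_of_le_one_right hc0 (gauge_le_one_of_mem hmem))
  have h2 : F w₀ = f w₀ := hFW ⟨w₀, hw₀W⟩
  rw [map_sub, h2] at h1
  linarith

end Extension

variable {α : Type*} [MetricSpace α] [CompactSpace α]

lemma exists_quadForm_bound {r : ℕ} {a : α → Mat r r} (ha : Continuous a) :
    ∃ M, 0 ≤ M ∧ ∀ z v, |v ⬝ᵥ a z *ᵥ v| ≤ M * (v ⬝ᵥ v) := by
  have hc : Continuous fun z => ∑ i, ∑ j, |a z i j| :=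
    continuous_finsetSum _ fun i _ => continuous_finsetSum _ fun j _ => (ha.matrix_elem i j).abs
  obtain ⟨M, hM⟩ := exists_bound_of_continuous hc
  refine ⟨|M|, abs_nonneg M, fun z v => (abs_dotProduct_mulVec_le _ _).trans ?_⟩
  refine mul_le_mul_of_nonneg_right ?_ (dotProduct_self_nonneg v)
  exact (le_abs_self _).trans ((hM z).trans (le_abs_self M))

lemma sq_add_le {s : ℕ} (x y : Fin s → ℝ) : 1 / 2 * ((x + y) ⬝ᵥ (x + y)) ≤ x ⬝ᵥ x + y ⬝ᵥ y := by
  have := dotProduct_self_nonneg (x - y)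
  simp only [add_dotProduct, dotProduct_add, sub_dotProduct, dotProduct_sub,
    dotProduct_comm y x] at *
  linarith

/-- A field with enough slack in the constraint is an interior point: it can be perturbed by
small multiples of any continuous field. -/
lemma add_smul_mem_constraintFields (h₁ : Λ₁.IsSymm) (h₂ : Λ₂.IsSymm)
    {w₀ : C(α, Mat n n × Mat n k × Mat n n)} {δ : ℝ} (hδ : 0 < δ)
    (hw₀ : ∀ z v, v ⬝ᵥ (w₀ z).1 *ᵥ v
      + (Λ₁ *ᵥ ((w₀ z).2.1ᵀ *ᵥ v)) ⬝ᵥ (Λ₁ *ᵥ ((w₀ z).2.1ᵀ *ᵥ v))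
      + (Λ₂ *ᵥ ((w₀ z).2.2ᵀ *ᵥ v)) ⬝ᵥ (Λ₂ *ᵥ ((w₀ z).2.2ᵀ *ᵥ v)) ≤ -(δ * (v ⬝ᵥ v)))
    (x : C(α, Mat n n × Mat n k × Mat n n)) :
    ∃ ε > 0, ∀ φ : C(α, ℝ), (∀ z, |φ z| ≤ ε) → w₀ + φ • x ∈ constraintFields Λ₁ Λ₂ α := by
  obtain ⟨M₀, hM₀, hb₀⟩ := exists_quadForm_bound (a := fun z => (x z).1) x.continuous.fst
  obtain ⟨M₁, hM₁, hb₁⟩ := exists_quadForm_bound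
    (a := fun z => (x z).2.1 * Λ₁ ^ 2 * (x z).2.1ᵀ)
    ((x.continuous.snd.fst.matrix_mul continuous_const).matrix_mul
      x.continuous.snd.fst.matrix_transpose)
  obtain ⟨M₂, hM₂, hb₂⟩ := exists_quadForm_bound
    (a := fun z => (x z).2.2 * Λ₂ ^ 2 * (x z).2.2ᵀ)
    ((x.continuous.snd.snd.matrix_mul continuous_const).matrix_mul
      x.continuous.snd.snd.matrix_transpose)
  set S := M₀ + M₁ + M₂ + 1 with hS
  have hSpos : 0 < S := by positivity
  refine ⟨min 1 (δ / S), by positivity, fun φ hφ z v => ?_⟩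
  have e1 : |φ z| ≤ 1 := (hφ z).trans (min_le_left _ _)
  have e2 : |φ z| * S ≤ δ := by
    rw [← le_div_iff₀ hSpos]
    exact (hφ z).trans (min_le_right _ _)
  have e3 : φ z ^ 2 ≤ |φ z| := by
    rw [← sq_abs]
    nlinarith [abs_nonneg (φ z)]
  have hv := dotProduct_self_nonneg v
  rw [dotProduct_hjExpr _ _ h₁ h₂]
  have c0 : (w₀ + φ • x) z = w₀ z + φ z • x z := rfl
  rw [c0]
  simp only [Prod.fst_add, Prod.snd_add, Prod.smul_fst, Prod.smul_snd, transpose_add,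
    transpose_smul, add_mulVec, smul_mulVec, mulVec_add, mulVec_smul, dotProduct_add,
    dotProduct_smul, smul_eq_mul]
  have q1 := sq_add_le (Λ₁ *ᵥ ((w₀ z).2.1ᵀ *ᵥ v)) (φ z • (Λ₁ *ᵥ ((x z).2.1ᵀ *ᵥ v)))
  have q2 := sq_add_le (Λ₂ *ᵥ ((w₀ z).2.2ᵀ *ᵥ v)) (φ z • (Λ₂ *ᵥ ((x z).2.2ᵀ *ᵥ v)))
  have b0 := hb₀ z v
  have b1 := hb₁ z v
  have b2 := hb₂ z v
  rw [dotProduct_mul_sq_mul _ h₁] at b1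
  rw [dotProduct_mul_sq_mul _ h₂] at b2
  have hw := hw₀ z v
  simp only [dotProduct_add, dotProduct_smul, smul_dotProduct, smul_eq_mul] at q1 q2 ⊢
  set N := v ⬝ᵥ v
  have p0 : φ z * (v ⬝ᵥ (x z).1 *ᵥ v) ≤ |φ z| * (M₀ * N) :=
    (le_abs_self _).trans (by rw [abs_mul]; exact mul_le_mul_of_nonneg_left b0 (abs_nonneg _))
  have p1 : ∀ y M : ℝ, 0 ≤ M → |y| ≤ M * N → φ z * (φ z * y) ≤ |φ z| * (M * N) := by
    intro y M hM hy
    have hMN : 0 ≤ M * N := mul_nonneg hM hv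
    calc φ z * (φ z * y) = φ z ^ 2 * y := by ring
      _ ≤ φ z ^ 2 * (M * N) := mul_le_mul_of_nonneg_left ((le_abs_self y).trans hy) (sq_nonneg _)
      _ ≤ |φ z| * (M * N) := mul_le_mul_of_nonneg_right e3 hMN
  have p2 := p1 _ _ hM₁ b1
  have p3 := p1 _ _ hM₂ b2
  have p4 : |φ z| * (M₀ * N) + |φ z| * (M₁ * N) + |φ z| * (M₂ * N) ≤ δ * N := by
    have : |φ z| * S * N ≤ δ * N := mul_le_mul_of_nonneg_right e2 hv
    have h5 : 0 ≤ |φ z| * N := mul_nonneg (abs_nonneg _) hv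
    rw [hS] at this
    nlinarith
  linarith

lemma sum_apply_smul_single {r s : ℕ} (A : Mat r s) :
    ∑ i, ∑ j, A i j • Matrix.single i j (1 : ℝ) = A := by
  conv_rhs => rw [Matrix.matrix_eq_sum_single A]
  simp [Matrix.smul_single]

variable [MeasurableSpace α] [BorelSpace α]

/-- A functional on continuous fields that is bounded above on a neighbourhood of some field is
represented, on the fields with symmetric first component, by some `μ ∈ M(α, 𝕏)`. -/
lemma exists_triple_of_functional (F : C(α, Mat n n × Mat n k × Mat n n) →ₗ[ℝ] ℝ) {c : ℝ}
    (w₀ : C(α, Mat n n × Mat n k × Mat n n))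
    (hF : ∀ x, ∃ ε > 0, ∀ φ : C(α, ℝ), (∀ z, |φ z| ≤ ε) → F (w₀ + φ • x) ≤ c) :
    ∃ μ : Triple α n k, ∀ Ξ : C(α, Mat n n × Mat n k × Mat n n), (∀ z, (Ξ z).1.IsSymm) →
      pairing3 μ Ξ = F Ξ := by
  have hex : ∀ e : Mat n n × Mat n k × Mat n n, ∃ σ : SignedMeasure α, ∀ φ : C(α, ℝ),
      VectorMeasure.integral σ φ (ContinuousLinearMap.lsmul ℝ ℝ).flip =
        F (φ • ContinuousMap.const α e) := by
    intro e
    obtain ⟨ε, hε, hb⟩ := hF (ContinuousMap.const α e)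
    let Fe : C(α, ℝ) →ₗ[ℝ] ℝ :=
      { toFun := fun φ => F (φ • ContinuousMap.const α e)
        map_add' := fun φ ψ => by rw [add_smul, map_add]
        map_smul' := fun t φ => by
          rw [RingHom.id_apply, ← map_smul]
          congr 1
          ext1 z
          exact mul_smul t (φ z) e }
    have hle : ∀ φ : C(α, ℝ), Fe φ ≤ (c - F w₀) / ε * ‖φ‖ := by
      intro φ
      rcases eq_or_ne φ 0 with rfl | hφ
      · simp
      · have hn : 0 < ‖φ‖ := norm_pos_iff.2 hφ
        have h := hb ((ε / ‖φ‖) • φ) fun z => by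
          have := φ.norm_coe_le_norm z
          rw [ContinuousMap.smul_apply, smul_eq_mul, abs_mul, abs_of_pos (div_pos hε hn),
            div_mul_eq_mul_div, div_le_iff₀ hn]
          exact mul_le_mul_of_nonneg_left this hε.le
        have h2 : F w₀ + Fe ((ε / ‖φ‖) • φ) ≤ c := by rwa [map_add] at h
        rw [map_smul, smul_eq_mul] at h2
        have h3 : ε / ‖φ‖ * Fe φ ≤ c - F w₀ := by linarith
        rw [div_mul_eq_mul_div, div_le_iff₀ hn] at h3
        rw [div_mul_eq_mul_div, le_div_iff₀ hε]
        linarith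
    refine exists_signedMeasure_of_bounded Fe (K := (c - F w₀) / ε) fun φ => abs_le.2 ⟨?_, hle φ⟩
    have := hle (-φ)
    rw [map_neg, norm_neg] at this
    linarith
  choose σ hσ using hex
  -- symmetrized basis elements make the first component symmetric
  let e₀ : Fin n → Fin n → Mat n n × Mat n k × Mat n n := fun i j =>
    ((1 / 2 : ℝ) • (Matrix.single i j (1 : ℝ) + Matrix.single j i (1 : ℝ)), 0, 0)
  let e₁ : Fin n → Fin k → Mat n n × Mat n k × Mat n n := fun i j =>
    (0, Matrix.single i j (1 : ℝ), 0)
  let e₂ : Fin n → Fin n → Mat n n × Mat n k × Mat n n := fun i j =>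
    (0, 0, Matrix.single i j (1 : ℝ))
  have hsymm : ∀ i j, e₀ i j = e₀ j i := fun i j => by
    simp only [e₀, add_comm]
  refine ⟨⟨ofEntries fun i j => σ (e₀ i j), ofEntries fun i j => σ (e₁ i j),
    ofEntries fun i j => σ (e₂ i j), fun A => ?_⟩, fun Ξ hΞ => ?_⟩
  · ext i j
    simp [hsymm j i]
  let a : Fin n → Fin n → C(α, ℝ) := fun i j =>
    ⟨fun z => (Ξ z).1 i j, Ξ.continuous.fst.matrix_elem i j⟩
  let b : Fin n → Fin k → C(α, ℝ) := fun i j =>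
    ⟨fun z => (Ξ z).2.1 i j, Ξ.continuous.snd.fst.matrix_elem i j⟩
  let d : Fin n → Fin n → C(α, ℝ) := fun i j =>
    ⟨fun z => (Ξ z).2.2 i j, Ξ.continuous.snd.snd.matrix_elem i j⟩
  have e : Ξ = ∑ i, ∑ j, a i j • ContinuousMap.const α (e₀ i j)
      + ∑ i, ∑ j, b i j • ContinuousMap.const α (e₁ i j)
      + ∑ i, ∑ j, d i j • ContinuousMap.const α (e₂ i j) := by
    ext1 z
    simp only [ContinuousMap.add_apply, ContinuousMap.coe_sum, Finset.sum_apply,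
      ContinuousMap.smul_apply', ContinuousMap.const_apply]
    refine Prod.ext ?_ (Prod.ext ?_ ?_)
    · simp only [Prod.fst_add, Prod.fst_sum, Prod.smul_fst, e₀, e₁, e₂, smul_zero,
        Finset.sum_const_zero, add_zero]
      have h1 := sum_apply_smul_single (Ξ z).1
      have h2 := congrArg Matrix.transpose h1
      rw [(hΞ z).eq] at h2
      simp only [transpose_sum, transpose_smul, transpose_single] at h2
      simp only [smul_comm _ (1 / 2 : ℝ), smul_add, Finset.sum_add_distrib, ← Finset.smul_sum]
      change (Ξ z).1 = (1 / 2 : ℝ) • ∑ i, ∑ j, (Ξ z).1 i j • Matrix.single i j (1 : ℝ)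
        + (1 / 2 : ℝ) • ∑ i, ∑ j, (Ξ z).1 i j • Matrix.single j i (1 : ℝ)
      rw [h1, h2]
      module
    · simp only [Prod.fst_add, Prod.snd_add, Prod.fst_sum, Prod.snd_sum, Prod.smul_fst,
        Prod.smul_snd, e₀, e₁, e₂, smul_zero, Finset.sum_const_zero, add_zero, zero_add]
      exact (sum_apply_smul_single (Ξ z).2.1).symm
    · simp only [Prod.snd_add, Prod.snd_sum,
        Prod.smul_snd, e₀, e₁, e₂, smul_zero, Finset.sum_const_zero, zero_add]
      exact (sum_apply_smul_single (Ξ z).2.2).symm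
  conv_rhs => rw [e]
  simp only [map_add, map_sum, ← hσ]
  simp only [pairing3, pairing, entry_ofEntries]
  rfl

/-- If a linear functional `f` is bounded by `c` on the fields of a subspace `W` that satisfy the
constraint, and `W` contains an interior point of the constraint, then `f` is represented on `W` by
a measure that is bounded by `c` on all continuous fields satisfying the constraint. -/
theorem exists_triple_of_le (h₁ : Λ₁.IsSymm) (h₂ : Λ₂.IsSymm)
    (W : Submodule ℝ C(α, Mat n n × Mat n k × Mat n n))
    (hWs : ∀ Ξ ∈ W, ∀ z, (Ξ z).1.IsSymm)
    (f : C(α, Mat n n × Mat n k × Mat n n) →ₗ[ℝ] ℝ) {c : ℝ}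
    (hfc : ∀ Ξ ∈ W, (∀ z, Ξ z ∈ OSet Λ₁ Λ₂) → f Ξ ≤ c)
    {w₀ : C(α, Mat n n × Mat n k × Mat n n)} (hw₀W : w₀ ∈ W) {δ : ℝ} (hδ : 0 < δ)
    (hw₀ : ∀ z v, v ⬝ᵥ (w₀ z).1 *ᵥ v
      + (Λ₁ *ᵥ ((w₀ z).2.1ᵀ *ᵥ v)) ⬝ᵥ (Λ₁ *ᵥ ((w₀ z).2.1ᵀ *ᵥ v))
      + (Λ₂ *ᵥ ((w₀ z).2.2ᵀ *ᵥ v)) ⬝ᵥ (Λ₂ *ᵥ ((w₀ z).2.2ᵀ *ᵥ v)) ≤ -(δ * (v ⬝ᵥ v))) :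
    ∃ μ : Triple α n k, (∀ Ξ ∈ W, pairing3 μ Ξ = f Ξ) ∧
      ∀ Ξ : α → Mat n n × Mat n k × Mat n n, Continuous Ξ → (∀ z, Ξ z ∈ OSet Λ₁ Λ₂) →
        pairing3 μ Ξ ≤ c := by
  have hint := add_smul_mem_constraintFields h₁ h₂ hδ hw₀
  obtain ⟨F, hFW, hF⟩ := exists_extension_le_on_constraintFields h₁ h₂ W f
    (fun Ξ hΞ hc => hfc Ξ hΞ fun z => (mem_OSet_iff _ _ h₁ h₂ _).2 ⟨hWs Ξ hΞ z, hc z⟩) hw₀W hint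
  obtain ⟨μ, hμ⟩ := exists_triple_of_functional F w₀ fun x => by
    obtain ⟨ε, hε, h⟩ := hint x
    exact ⟨ε, hε, fun φ hφ => hF _ (h φ hφ)⟩
  refine ⟨μ, fun Ξ hΞ => (hμ Ξ (hWs Ξ hΞ)).trans (hFW Ξ hΞ), fun Ξ hΞ hO => ?_⟩
  refine (hμ ⟨Ξ, hΞ⟩ fun z => (hO z).1).trans_le (hF _ fun z v => ?_)
  exact ((mem_OSet_iff _ _ h₁ h₂ _).1 (hO z)).2 v

end Existence

/-! ### Test fields on the time-space domain -/

section Fields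

variable {d n k : ℕ} {Ω : Set (E d)}

lemma uniqueDiffOn_Q {U : Set (E d)} (hU : IsOpen U) (hc : Convex ℝ U) (hΩ : Ω = closure U) :
    UniqueDiffOn ℝ (Q Ω) := by
  refine (uniqueDiffOn_Icc zero_lt_one).prod ?_
  rcases U.eq_empty_or_nonempty with rfl | hne
  · rw [hΩ, closure_empty]
    exact uniqueDiffOn_empty
  · rw [hΩ]
    exact uniqueDiffOn_convex hc.closure
      (hne.mono (interior_maximal subset_closure hU))

lemma compactSpace_Q [CompactSpace Ω] : CompactSpace (Q Ω) :=
  isCompact_iff_compactSpace.1 (isCompact_Icc.prod (isCompact_iff_compactSpace.2 inferInstance))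

lemma IsC1.differentiableWithinAt {Φ : ℝ × E d → Mat n n} (hΦ : IsC1 Ω Φ) {z : ℝ × E d}
    (hz : z ∈ Q Ω) (i j : Fin n) : DifferentiableWithinAt ℝ (fun y => Φ y i j) (Q Ω) z :=
  (hΦ.2 i j).differentiableOn one_ne_zero z hz

lemma IsC1.add {Φ Ψ : ℝ × E d → Mat n n} (hΦ : IsC1 Ω Φ) (hΨ : IsC1 Ω Ψ) :
    IsC1 Ω (Φ + Ψ) :=
  ⟨fun z hz => (hΦ.1 z hz).add (hΨ.1 z hz), fun i j => (hΦ.2 i j).add (hΨ.2 i j)⟩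

lemma IsC1.smul {Φ : ℝ × E d → Mat n n} (hΦ : IsC1 Ω Φ) (c : ℝ) : IsC1 Ω (c • Φ) :=
  ⟨fun z hz => (hΦ.1 z hz).smul c, fun i j => (hΦ.2 i j).const_smul c⟩

lemma dirDeriv_add (hQ : UniqueDiffOn ℝ (Q Ω)) {Φ Ψ : ℝ × E d → Mat n n} (hΦ : IsC1 Ω Φ)
    (hΨ : IsC1 Ω Ψ) (v : ℝ × E d) {z : ℝ × E d} (hz : z ∈ Q Ω) :
    dirDeriv Ω v (Φ + Ψ) z = dirDeriv Ω v Φ z + dirDeriv Ω v Ψ z := by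
  ext i j
  have := fderivWithin_fun_add (hQ z hz) (hΦ.differentiableWithinAt hz i j)
    (hΨ.differentiableWithinAt hz i j)
  exact congrArg (fun f : (ℝ × E d) →L[ℝ] ℝ => f v) this

lemma dirDeriv_smul (hQ : UniqueDiffOn ℝ (Q Ω)) {Φ : ℝ × E d → Mat n n} (hΦ : IsC1 Ω Φ) (c : ℝ)
    (v : ℝ × E d) {z : ℝ × E d} (hz : z ∈ Q Ω) :
    dirDeriv Ω v (c • Φ) z = c • dirDeriv Ω v Φ z := by
  ext i j
  have := fderivWithin_fun_const_smul (hQ z hz) (hΦ.differentiableWithinAt hz i j) c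
  exact congrArg (fun f : (ℝ × E d) →L[ℝ] ℝ => f v) this

lemma isSymm_dirDeriv {Φ : ℝ × E d → Mat n n} (hΦ : IsC1 Ω Φ) (v : ℝ × E d) {z : ℝ × E d}
    (hz : z ∈ Q Ω) : (dirDeriv Ω v Φ z).IsSymm := by
  ext i j
  simp only [dirDeriv, transpose_apply, of_apply]
  rw [fderivWithin_congr (fun y hy => (hΦ.1 y hy).apply i j) ((hΦ.1 z hz).apply i j)]

lemma continuous_dirDeriv (hQ : UniqueDiffOn ℝ (Q Ω)) {Φ : ℝ × E d → Mat n n} (hΦ : IsC1 Ω Φ)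
    (v : ℝ × E d) : Continuous fun z : Q Ω => dirDeriv Ω v Φ z := by
  refine continuous_matrix fun i j => ?_
  have h : ContinuousOn (fun z => fderivWithin ℝ (fun y => Φ y i j) (Q Ω) z v) (Q Ω) :=
    ((hΦ.2 i j).continuousOn_fderivWithin hQ le_rfl).clm_apply continuousOn_const
  exact h.domRestrict

lemma IsC1.continuous {Φ : ℝ × E d → Mat n n} (hΦ : IsC1 Ω Φ) :
    Continuous fun z : Q Ω => Φ z :=
  continuous_matrix fun i j => (hΦ.2 i j).continuousOn.domRestrict

lemma continuous_linearMap_mat {r s r' s' : ℕ} (T : Mat r s →ₗ[ℝ] Mat r' s') : Continuous T := by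
  have : ⇑T = fun A : Mat r s => ∑ i, ∑ j, A i j • T (Matrix.single i j 1) := by
    funext A
    conv_lhs => rw [← sum_apply_smul_single A]
    simp only [map_sum, map_smul]
  rw [this]
  exact continuous_finsetSum _ fun i _ => continuous_finsetSum _ fun j _ =>
    (continuous_id.matrix_elem i j).smul continuous_const

lemma continuous_LOp (hQ : UniqueDiffOn ℝ (Q Ω)) (D : DiffOp d n k) {Φ : ℝ × E d → Mat n n}
    (hΦ : IsC1 Ω Φ) : Continuous (LOp D Ω Φ) := by
  refine (continuous_dirDeriv hQ hΦ _).prodMk (Continuous.prodMk ?_ hΦ.continuous)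
  exact ((continuous_linearMap_mat D.D0).comp hΦ.continuous).add
    (continuous_finsetSum _ fun l _ =>
      (continuous_linearMap_mat (D.D1 l)).comp (continuous_dirDeriv hQ hΦ _))

lemma LOp_add (hQ : UniqueDiffOn ℝ (Q Ω)) (D : DiffOp d n k) {Φ Ψ : ℝ × E d → Mat n n}
    (hΦ : IsC1 Ω Φ) (hΨ : IsC1 Ω Ψ) (z : Q Ω) :
    LOp D Ω (Φ + Ψ) z = LOp D Ω Φ z + LOp D Ω Ψ z := by
  simp only [LOp, dt, DiffOp.apply, dirDeriv_add hQ hΦ hΨ _ z.2, Pi.add_apply, map_add,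
    Finset.sum_add_distrib, Prod.mk_add_mk]
  rw [add_add_add_comm]

lemma LOp_smul (hQ : UniqueDiffOn ℝ (Q Ω)) (D : DiffOp d n k) {Φ : ℝ × E d → Mat n n}
    (hΦ : IsC1 Ω Φ) (c : ℝ) (z : Q Ω) : LOp D Ω (c • Φ) z = c • LOp D Ω Φ z := by
  simp only [LOp, dt, DiffOp.apply, dirDeriv_smul hQ hΦ c _ z.2, Pi.smul_apply, map_smul,
    ← Finset.smul_sum, Prod.smul_mk, smul_add]

lemma isC1_zero : IsC1 Ω (0 : ℝ × E d → Mat n n) :=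
  ⟨fun _ _ => Matrix.transpose_zero, fun _ _ => contDiffOn_const⟩

/-- The range of `L` on `C^1(Q, S^n)`, as a subspace of the continuous fields. -/
def rangeL (hQ : UniqueDiffOn ℝ (Q Ω)) (D : DiffOp d n k) :
    Submodule ℝ C(Q Ω, Mat n n × Mat n k × Mat n n) where
  carrier := {Ξ | ∃ Φ, IsC1 Ω Φ ∧ ∀ z, Ξ z = LOp D Ω Φ z}
  add_mem' := by
    rintro _ _ ⟨Φ, hΦ, h⟩ ⟨Ψ, hΨ, h'⟩
    exact ⟨Φ + Ψ, hΦ.add hΨ, fun z => by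
      rw [LOp_add hQ D hΦ hΨ, ← h, ← h', ContinuousMap.add_apply]⟩
  zero_mem' := ⟨(0 : ℝ) • 0, isC1_zero.smul 0, fun z => by
    rw [LOp_smul hQ D isC1_zero, zero_smul, ContinuousMap.zero_apply]⟩
  smul_mem' := by
    rintro c _ ⟨Φ, hΦ, h⟩
    exact ⟨c • Φ, hΦ.smul c, fun z => by
      rw [LOp_smul hQ D hΦ, ← h, ContinuousMap.smul_apply]⟩

/-- The slice `x ↦ (t, x)` of the time-space domain. -/
def slice (Ω : Set (E d)) (t : Icc (0 : ℝ) 1) : C(Ω, Q Ω) :=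
  ⟨fun x => ⟨((t : ℝ), (x : E d)), t.2, x.2⟩, by fun_prop⟩

/-- The dual objective `⟨G₁, Φ₁⟩ - ⟨G₀, Φ₀⟩` as a functional of the third component of `L Φ`. -/
noncomputable def endFunctional [CompactSpace Ω] (k : ℕ) (G₀ G₁ : VectorMeasure Ω (Mat n n)) :
    C(Q Ω, Mat n n × Mat n k × Mat n n) →ₗ[ℝ] ℝ where
  toFun Ξ := pairing G₁ (fun x => (Ξ (slice Ω 1 x)).2.2)
    - pairing G₀ (fun x => (Ξ (slice Ω 0 x)).2.2)
  map_add' Ξ Ξ' := by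
    have h : ∀ (Ξ : C(Q Ω, Mat n n × Mat n k × Mat n n)) t,
        Continuous fun x => (Ξ (slice Ω t x)).2.2 :=
      fun Ξ t => (Ξ.continuous.comp (slice Ω t).continuous).snd.snd
    have e₁ := pairing_add G₁ (h Ξ 1) (h Ξ' 1)
    have e₀ := pairing_add G₀ (h Ξ 0) (h Ξ' 0)
    simp only [ContinuousMap.add_apply, Prod.snd_add]
    rw [e₁, e₀]
    ring
  map_smul' c Ξ := by
    have h : ∀ t, Continuous fun x => (Ξ (slice Ω t x)).2.2 :=
      fun t => (Ξ.continuous.comp (slice Ω t).continuous).snd.snd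
    have e₁ := pairing_smul G₁ c (h 1)
    have e₀ := pairing_smul G₀ c (h 0)
    simp only [ContinuousMap.smul_apply, Prod.smul_snd]
    rw [e₁, e₀, RingHom.id_apply, smul_eq_mul]
    ring

lemma endFunctional_eq [CompactSpace Ω] (G₀ G₁ : VectorMeasure Ω (Mat n n)) (D : DiffOp d n k)
    {Φ : ℝ × E d → Mat n n} {Ξ : C(Q Ω, Mat n n × Mat n k × Mat n n)}
    (h : ∀ z, Ξ z = LOp D Ω Φ z) : endFunctional k G₀ G₁ Ξ = endPairing G₀ G₁ Φ := by
  simp only [endFunctional, LinearMap.coe_mk, AddHom.coe_mk, h]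
  rfl

/-! ### A field with slack in the dual constraint -/

lemma hasFDerivWithinAt_mul_fst (η a : ℝ) (s : Set (ℝ × E d)) (z : ℝ × E d) :
    HasFDerivWithinAt (fun y : ℝ × E d => y.1 * (η * a))
      ((η * a) • ContinuousLinearMap.fst ℝ ℝ (E d)) s z := by
  have h := (ContinuousLinearMap.fst ℝ ℝ (E d)).hasFDerivWithinAt (x := z) (s := s)
  exact h.mul_const (η * a)

/-- The field `t η I`; its image under `L` is `(η I, 0, t η I)` because `D^* I = 0`. -/
lemma LOp_time_smul_one (hQ : UniqueDiffOn ℝ (Q Ω)) (D : DiffOp d n k) (η : ℝ) :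
    IsC1 Ω (fun z : ℝ × E d => (z.1 * η) • (1 : Mat n n)) ∧
      ∀ z : Q Ω, LOp D Ω (fun z : ℝ × E d => (z.1 * η) • (1 : Mat n n)) z =
        (η • 1, 0, ((z : ℝ × E d).1 * η) • 1) := by
  have hd : ∀ (v : ℝ × E d) (z : Q Ω),
      dirDeriv Ω v (fun z : ℝ × E d => (z.1 * η) • (1 : Mat n n)) z = (v.1 * η) • 1 := by
    intro v z
    ext i j
    have := (hasFDerivWithinAt_mul_fst η ((1 : Mat n n) i j) (Q Ω) z).fderivWithin (hQ z z.2)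
    simp only [dirDeriv, of_apply, Matrix.smul_apply, smul_eq_mul, mul_assoc, this]
    simp
    ring
  refine ⟨⟨fun z _ => Matrix.isSymm_one.smul _, fun i j => ?_⟩, fun z => ?_⟩
  · exact ((contDiff_fst.mul contDiff_const).smul contDiff_const).contDiffOn
  · simp [LOp, dt, DiffOp.apply, hd, D.map_one]

/-- For small `η > 0` the field `-t η I` satisfies the dual constraint with slack. -/
lemma exists_slack_field (hQ : UniqueDiffOn ℝ (Q Ω)) (D : DiffOp d n k) (Λ₁ : Mat k k)
    (Λ₂ : Mat n n) (h₂ : Λ₂.IsSymm) : ∃ w₀ ∈ rangeL hQ D, ∃ δ > 0, ∀ z v,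
      v ⬝ᵥ (w₀ z).1 *ᵥ v
      + (Λ₁ *ᵥ ((w₀ z).2.1ᵀ *ᵥ v)) ⬝ᵥ (Λ₁ *ᵥ ((w₀ z).2.1ᵀ *ᵥ v))
      + (Λ₂ *ᵥ ((w₀ z).2.2ᵀ *ᵥ v)) ⬝ᵥ (Λ₂ *ᵥ ((w₀ z).2.2ᵀ *ᵥ v)) ≤ -(δ * (v ⬝ᵥ v)) := by
  set M := ∑ i, ∑ j, |(Λ₂ ^ 2 : Mat n n) i j| with hM
  have hM0 : 0 ≤ M := Finset.sum_nonneg fun i _ => Finset.sum_nonneg fun j _ => abs_nonneg _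
  have hb : ∀ v : Fin n → ℝ, (Λ₂ *ᵥ v) ⬝ᵥ (Λ₂ *ᵥ v) ≤ M * (v ⬝ᵥ v) := fun v => by
    have h := dotProduct_mul_sq_mul Λ₂ h₂ 1 v
    simp only [one_mul, mul_one, transpose_one, one_mulVec] at h
    rw [← h]
    exact (le_abs_self _).trans (abs_dotProduct_mulVec_le _ v)
  set η : ℝ := 1 / (2 * (M + 1)) with hη
  have hη0 : 0 < η := by positivity
  have hηM : η * M ≤ 1 / 2 := by
    rw [hη, div_mul_eq_mul_div, one_mul, div_le_div_iff₀ (by positivity) (by norm_num)]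
    linarith
  obtain ⟨hC, hL⟩ := LOp_time_smul_one (n := n) hQ D (-η)
  refine ⟨⟨_, continuous_LOp hQ D hC⟩, ⟨_, hC, fun z => rfl⟩, η / 2, by positivity,
    fun z v => ?_⟩
  simp only [ContinuousMap.coe_mk, hL, smul_mulVec, one_mulVec, transpose_zero, zero_mulVec,
    mulVec_zero, dotProduct_zero, transpose_smul, transpose_one, mulVec_smul, dotProduct_smul,
    smul_dotProduct, smul_eq_mul]
  obtain ⟨ht0, ht1⟩ := z.2.1
  set t := (z : ℝ × E d).1
  have hv := dotProduct_self_nonneg v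
  have hbv := hb v
  have ht2 : t * t ≤ 1 := by nlinarith
  have hsq := dotProduct_self_nonneg (Λ₂ *ᵥ v)
  generalize (Λ₂ *ᵥ v) ⬝ᵥ (Λ₂ *ᵥ v) = R at *
  generalize v ⬝ᵥ v = N at *
  have h1 : t * t * R ≤ M * N := (mul_le_of_le_one_left hsq ht2).trans hbv
  have h2 : η * η * (t * t * R) ≤ η * η * (M * N) :=
    mul_le_mul_of_nonneg_left h1 (mul_nonneg hη0.le hη0.le)
  have h3 : η * N * (η * M) ≤ η * N * (1 / 2) :=
    mul_le_mul_of_nonneg_left hηM (mul_nonneg hη0.le hv)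
  linarith

/-! ### Boundedness of the dual problem -/

/-- A Riccati-type differential inequality bounds the end values of `y` independently of `y`: the
functions `t² y(t) - κ t` and `(1 - t)² y(t) - κ t` are nonincreasing. -/
lemma riccati_bound {y y' : ℝ → ℝ} {κ : ℝ} (hy : ContinuousOn y (Icc 0 1))
    (hd : ∀ t ∈ Ioo (0 : ℝ) 1, HasDerivAt y (y' t) t)
    (hle : ∀ t ∈ Ioo (0 : ℝ) 1, ∀ s : ℝ, 2 * s * y t + s ^ 2 * y' t ≤ κ) :
    y 1 ≤ κ ∧ -y 0 ≤ κ := by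
  have h0 : (0 : ℝ) ∈ Icc (0 : ℝ) 1 := by simp
  have h1 : (1 : ℝ) ∈ Icc (0 : ℝ) 1 := by simp
  constructor
  · have hanti : AntitoneOn (fun t => t ^ 2 * y t - κ * t) (Icc 0 1) := by
      refine antitoneOn_of_hasDerivWithinAt_nonpos (convex_Icc 0 1)
        (f' := fun t => 2 * t * y t + t ^ 2 * y' t - κ) (by fun_prop) ?_ ?_
      · intro t ht
        rw [interior_Icc] at ht
        have := ((hasDerivAt_pow 2 t).mul (hd t ht)).sub ((hasDerivAt_id t).const_mul κ)
        refine (this.congr_deriv ?_).hasDerivWithinAt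
        simp
      · intro t ht
        rw [interior_Icc] at ht
        have := hle t ht t
        linarith
    have := hanti h0 h1 zero_le_one
    norm_num at this
    linarith
  · have hanti : AntitoneOn (fun t => (1 - t) ^ 2 * y t - κ * t) (Icc 0 1) := by
      refine antitoneOn_of_hasDerivWithinAt_nonpos (convex_Icc 0 1)
        (f' := fun t => 2 * (t - 1) * y t + (t - 1) ^ 2 * y' t - κ) (by fun_prop) ?_ ?_
      · intro t ht
        rw [interior_Icc] at ht
        have := ((((hasDerivAt_id t).const_sub 1).pow 2).mul (hd t ht)).sub
          ((hasDerivAt_id t).const_mul κ)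
        refine (this.congr_deriv ?_).hasDerivWithinAt
        simp
        ring
      · intro t ht
        rw [interior_Icc] at ht
        have := hle t ht (t - 1)
        linarith
    have := hanti h0 h1 zero_le_one
    norm_num at this
    linarith

lemma hasDerivWithinAt_time {Φ : ℝ × E d → Mat n n} (hΦ : IsC1 Ω Φ) {x : E d} (hx : x ∈ Ω)
    {t : ℝ} (ht : t ∈ Icc (0 : ℝ) 1) (v : Fin n → ℝ) :
    HasDerivWithinAt (fun τ => v ⬝ᵥ Φ (τ, x) *ᵥ v) (v ⬝ᵥ dt Ω Φ (t, x) *ᵥ v)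
      (Icc 0 1) t := by
  have hent : ∀ i j, HasDerivWithinAt (fun τ => Φ (τ, x) i j) (dt Ω Φ (t, x) i j)
      (Icc 0 1) t := by
    intro i j
    have h1 := (hΦ.differentiableWithinAt (z := (t, x)) ⟨ht, hx⟩ i j).hasFDerivWithinAt
    have h2 : HasDerivWithinAt (fun τ : ℝ => (τ, x)) ((1 : ℝ), (0 : E d)) (Icc 0 1) t :=
      (hasDerivWithinAt_id t _).prodMk (hasDerivWithinAt_const t _ x)
    have h3 : MapsTo (fun τ : ℝ => (τ, x)) (Icc 0 1) (Q Ω) := fun τ hτ => ⟨hτ, hx⟩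
    exact h1.comp_hasDerivWithinAt t h2 h3
  simp only [dotProduct, mulVec, Finset.mul_sum]
  exact HasDerivWithinAt.fun_sum fun i _ => HasDerivWithinAt.fun_sum fun j _ =>
    ((hent i j).mul_const (v j)).const_mul (v i)

/-- The end values of a dual feasible field are bounded in the semidefinite order. -/
lemma exists_bound_of_dualFeasible (D : DiffOp d n k) (Λ₁ : Mat k k)
    (Λ₂ : Mat n n) (h₁ : Λ₁.IsSymm) (h₂ : Λ₂.PosDef) :
    ∃ K : ℝ, ∀ Φ ∈ dualFeasible D Λ₁ Λ₂ Ω, ∀ x ∈ Ω,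
      (K • (1 : Mat n n) + (-1 : ℝ) • Φ (1, x)).PosSemidef ∧
        (K • (1 : Mat n n) + Φ (0, x)).PosSemidef := by
  have h₂s : Λ₂.IsSymm := ((posSemidef_iff_real _).1 h₂.posSemidef).1
  have hdet : IsUnit Λ₂.det := (Matrix.isUnit_iff_isUnit_det _).1 h₂.isUnit
  refine ⟨2 * ∑ i, ∑ j, |(Λ₂⁻¹ᵀ * Λ₂⁻¹) i j|, fun Φ hΦ x hx => ?_⟩
  obtain ⟨hC, hO⟩ := hΦ
  have h0 : (0 : ℝ) ∈ Icc (0 : ℝ) 1 := by simp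
  have h1 : (1 : ℝ) ∈ Icc (0 : ℝ) 1 := by simp
  have key : ∀ v : Fin n → ℝ,
      v ⬝ᵥ Φ (1, x) *ᵥ v ≤ (2 * ∑ i, ∑ j, |(Λ₂⁻¹ᵀ * Λ₂⁻¹) i j|) * (v ⬝ᵥ v) ∧
      -(v ⬝ᵥ Φ (0, x) *ᵥ v) ≤ (2 * ∑ i, ∑ j, |(Λ₂⁻¹ᵀ * Λ₂⁻¹) i j|) * (v ⬝ᵥ v) := by
    intro v
    have ha : (Λ₂⁻¹ *ᵥ v) ⬝ᵥ (Λ₂⁻¹ *ᵥ v) ≤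
        (∑ i, ∑ j, |(Λ₂⁻¹ᵀ * Λ₂⁻¹) i j|) * (v ⬝ᵥ v) := by
      refine le_trans (le_of_eq ?_) ((le_abs_self _).trans (abs_dotProduct_mulVec_le _ v))
      rw [← mulVec_mulVec, dotProduct_mulVec v, vecMul_transpose]
    have hb := riccati_bound (y := fun τ => v ⬝ᵥ Φ (τ, x) *ᵥ v)
      (y' := fun τ => v ⬝ᵥ dt Ω Φ (τ, x) *ᵥ v) (κ := 2 * ((Λ₂⁻¹ *ᵥ v) ⬝ᵥ (Λ₂⁻¹ *ᵥ v)))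
      (fun t ht => (hasDerivWithinAt_time hC hx ht v).continuousWithinAt)
      (fun t ht => (hasDerivWithinAt_time hC hx (Ioo_subset_Icc_self ht) v).hasDerivAt
        (Icc_mem_nhds ht.1 ht.2)) ?_
    · have hb1 : v ⬝ᵥ Φ (1, x) *ᵥ v ≤ _ := hb.1
      have hb0 : -(v ⬝ᵥ Φ (0, x) *ᵥ v) ≤ _ := hb.2
      constructor <;> linarith
    · intro t ht s
      have htI := Ioo_subset_Icc_self ht
      have hz := ((mem_OSet_iff Λ₁ Λ₂ h₁ h₂s _).1 (hO ⟨(t, x), htI, hx⟩)).2 v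
      rw [dotProduct_hjExpr _ _ h₁ h₂s] at hz
      simp only [LOp, (hC.1 (t, x) ⟨htI, hx⟩).eq] at hz
      have hp := dotProduct_self_nonneg (Λ₁ *ᵥ ((D.apply Ω Φ (t, x))ᵀ *ᵥ v))
      set a := Λ₂⁻¹ *ᵥ v with ha'
      set b := Λ₂ *ᵥ (Φ (t, x) *ᵥ v) with hb'
      have hab : v ⬝ᵥ Φ (t, x) *ᵥ v = a ⬝ᵥ b := by
        have e : Λ₂⁻¹ᵀ = Λ₂⁻¹ := by rw [transpose_nonsing_inv, h₂s.eq]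
        rw [ha', hb', ← e, mulVec_transpose, ← dotProduct_mulVec, mulVec_mulVec,
          nonsing_inv_mul _ hdet, one_mulVec]
      have hsq := dotProduct_self_nonneg ((2 : ℝ) • a - s • b)
      simp only [sub_dotProduct, dotProduct_sub, smul_dotProduct, dotProduct_smul, smul_eq_mul,
        dotProduct_comm b a] at hsq
      rw [hab]
      have hz' : v ⬝ᵥ dt Ω Φ (t, x) *ᵥ v ≤ -(1 / 2 * (b ⬝ᵥ b)) := by linarith
      have := mul_le_mul_of_nonneg_left hz' (sq_nonneg s)
      nlinarith
  constructor
  · refine (posSemidef_iff_real _).2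
      ⟨(Matrix.isSymm_one.smul _).add ((hC.1 _ ⟨h1, hx⟩).smul _), fun v => ?_⟩
    have := (key v).1
    simp only [add_mulVec, smul_mulVec, one_mulVec, dotProduct_add, dotProduct_smul, smul_eq_mul]
    linarith
  · refine (posSemidef_iff_real _).2
      ⟨(Matrix.isSymm_one.smul _).add (hC.1 _ ⟨h0, hx⟩), fun v => ?_⟩
    have := (key v).2
    simp only [add_mulVec, smul_mulVec, one_mulVec, dotProduct_add, dotProduct_smul, smul_eq_mul]
    linarith

/-- The dual problem is bounded above. -/
lemma exists_endPairing_le [CompactSpace Ω] (D : DiffOp d n k) (Λ₁ : Mat k k)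
    (Λ₂ : Mat n n) (h₁ : Λ₁.IsSymm) (h₂ : Λ₂.PosDef) {G₀ G₁ : VectorMeasure Ω (Mat n n)}
    (hG₀ : IsPSDValued G₀) (hG₁ : IsPSDValued G₁) :
    ∃ C : ℝ, ∀ Φ ∈ dualFeasible D Λ₁ Λ₂ Ω, endPairing G₀ G₁ Φ ≤ C := by
  obtain ⟨K, hK⟩ := exists_bound_of_dualFeasible (Ω := Ω) D Λ₁ Λ₂ h₁ h₂
  refine ⟨pairing G₁ (fun _ => K • 1) + pairing G₀ (fun _ => K • 1), fun Φ hΦ => ?_⟩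
  have hc : ∀ t : Icc (0 : ℝ) 1, Continuous fun x : Ω => Φ ((t : ℝ), (x : E d)) := fun t =>
    hΦ.1.continuous.comp (slice Ω t).continuous
  have c1 : Continuous fun x : Ω => Φ (1, (x : E d)) := hc 1
  have c0 : Continuous fun x : Ω => Φ (0, (x : E d)) := hc 0
  have cK : Continuous fun _ : Ω => K • (1 : Mat n n) := continuous_const
  have cn : Continuous fun x : Ω => (-1 : ℝ) • Φ (1, (x : E d)) :=
    (c1.const_smul (-1 : ℝ) :)
  have s1 : Continuous fun x : Ω => K • (1 : Mat n n) + (-1 : ℝ) • Φ (1, (x : E d)) := cK.add cn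
  have s0 : Continuous fun x : Ω => K • (1 : Mat n n) + Φ (0, (x : E d)) := cK.add c0
  have p1 := pairing_nonneg hG₁ s1 fun x => (hK Φ hΦ x x.2).1
  have p0 := pairing_nonneg hG₀ s0 fun x => (hK Φ hΦ x x.2).2
  have q1 := pairing_add G₁ cK cn
  have q0 := pairing_add G₀ cK c0
  have r1 := pairing_smul G₁ (-1) c1
  simp only [endPairing]
  linarith

end Fields

/-! ### Duality and optimality -/

section Duality

variable {d n k : ℕ} {Ω : Set (E d)} [CompactSpace Ω] {D : DiffOp d n k} {Λ₁ : Mat k k}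
  {Λ₂ : Mat n n} {G₀ G₁ : VectorMeasure Ω (Mat n n)}

/-- Weak duality. -/
lemma dualValue_le_action (hQ : UniqueDiffOn ℝ (Q Ω)) {μ : Triple (Q Ω) n k}
    (hμ : μ ∈ CE D G₀ G₁) : dualValue D Λ₁ Λ₂ G₀ G₁ ≤ (action Λ₁ Λ₂ μ : EReal) := by
  have := compactSpace_Q (Ω := Ω)
  refine iSup₂_le fun Φ hΦ => ?_
  rw [← hμ Φ hΦ.1]
  exact pairing3_le_action Λ₁ Λ₂ (continuous_LOp hQ D hΦ.1) hΦ.2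

/-- Strong duality: some solution of the continuity equation has action at most the dual value. -/
theorem exists_mem_CE_action_le (hQ : UniqueDiffOn ℝ (Q Ω)) (h₁ : Λ₁.IsSymm) (h₂ : Λ₂.PosDef)
    (hG₀ : IsPSDValued G₀) (hG₁ : IsPSDValued G₁) :
    ∃ μ ∈ CE D G₀ G₁, (action Λ₁ Λ₂ μ : EReal) ≤ dualValue D Λ₁ Λ₂ G₀ G₁ ∧
      action Λ₁ Λ₂ μ ≠ ⊤ := by
  have := compactSpace_Q (Ω := Ω)
  have h₂s : Λ₂.IsSymm := ((posSemidef_iff_real _).1 h₂.posSemidef).1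
  obtain ⟨C, hC⟩ := exists_endPairing_le D Λ₁ Λ₂ h₁ h₂ hG₀ hG₁
  have hle : ∀ Φ ∈ dualFeasible D Λ₁ Λ₂ Ω,
      ((endPairing G₀ G₁ Φ : ℝ) : EReal) ≤ dualValue D Λ₁ Λ₂ G₀ G₁ := fun Φ hΦ =>
    le_iSup₂ (f := fun Φ (_ : Φ ∈ dualFeasible D Λ₁ Λ₂ Ω) =>
      ((endPairing G₀ G₁ Φ : ℝ) : EReal)) Φ hΦ
  have hzero : (0 : ℝ × E d → Mat n n) ∈ dualFeasible D Λ₁ Λ₂ Ω := by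
    refine ⟨isC1_zero, fun z => ?_⟩
    have h := LOp_smul hQ D (isC1_zero (n := n)) 0 z
    rw [zero_smul, zero_smul] at h
    rw [h]
    exact zero_mem_OSet Λ₁ Λ₂
  have hnn : (0 : EReal) ≤ dualValue D Λ₁ Λ₂ G₀ G₁ := by
    refine le_trans (le_of_eq ?_) (hle 0 hzero)
    have hp : ∀ m : VectorMeasure Ω (Mat n n), pairing m (fun _ => 0) = 0 := fun m => by
      have h := pairing_smul m 0 (continuous_const (y := (0 : Mat n n)))
      rwa [smul_zero, zero_mul] at h
    have : endPairing G₀ G₁ (0 : ℝ × E d → Mat n n) = 0 := by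
      simp only [endPairing, Pi.zero_apply]
      rw [hp, hp, sub_zero]
    rw [this, EReal.coe_zero]
  have htop : dualValue D Λ₁ Λ₂ G₀ G₁ ≠ ⊤ := by
    refine ne_top_of_le_ne_top (EReal.coe_ne_top C) (iSup₂_le fun Φ hΦ => ?_)
    exact EReal.coe_le_coe_iff.2 (hC Φ hΦ)
  have hbot : dualValue D Λ₁ Λ₂ G₀ G₁ ≠ ⊥ := by
    intro h
    rw [h] at hnn
    exact absurd hnn (by simp)
  have hcoe := EReal.coe_toReal htop hbot
  set c := (dualValue D Λ₁ Λ₂ G₀ G₁).toReal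
  have hc0 : 0 ≤ c := by rwa [← EReal.coe_nonneg, hcoe]
  obtain ⟨w₀, hw₀, δ, hδ, hslack⟩ := exists_slack_field hQ D Λ₁ Λ₂ h₂s
  obtain ⟨μ, hμW, hμ⟩ := exists_triple_of_le h₁ h₂s (rangeL hQ D)
    (by
      rintro Ξ ⟨Φ, hΦ, h⟩ z
      rw [h]
      exact isSymm_dirDeriv hΦ _ z.2)
    (endFunctional k G₀ G₁) (c := c)
    (by
      rintro Ξ ⟨Φ, hΦ, h⟩ hO
      rw [endFunctional_eq G₀ G₁ D h, ← EReal.coe_le_coe_iff, hcoe]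
      exact hle Φ ⟨hΦ, fun z => h z ▸ hO z⟩)
    hw₀ hδ hslack
  have hact := action_le Λ₁ Λ₂ h₁ h₂s hμ
  refine ⟨μ, fun Φ hΦ => ?_, ?_, ne_top_of_le_ne_top ENNReal.ofReal_ne_top hact⟩
  · have hmem : (⟨LOp D Ω Φ, continuous_LOp hQ D hΦ⟩ : C(Q Ω, Mat n n × Mat n k × Mat n n)) ∈
        rangeL hQ D := ⟨Φ, hΦ, fun _ => rfl⟩
    exact (hμW _ hmem).trans (endFunctional_eq G₀ G₁ D fun _ => rfl)
  · refine (EReal.coe_ennreal_le_coe_ennreal_iff.2 hact).trans (le_of_eq ?_)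
    rw [EReal.coe_ennreal_ofReal, max_eq_left hc0, hcoe]

lemma WBsq_eq_action (hQ : UniqueDiffOn ℝ (Q Ω)) {μ : Triple (Q Ω) n k}
    (hμ : μ ∈ CE D G₀ G₁) (hle : (action Λ₁ Λ₂ μ : EReal) ≤ dualValue D Λ₁ Λ₂ G₀ G₁) :
    WBsq D Λ₁ Λ₂ G₀ G₁ = action Λ₁ Λ₂ μ := by
  refine le_antisymm (iInf₂_le μ hμ) (le_iInf₂ fun ν hν => ?_)
  exact EReal.coe_ennreal_le_coe_ennreal_iff.1 (hle.trans (dualValue_le_action hQ hν))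

/-- Subgradients in terms of the densities. -/
lemma isSubgradient_LOp_iff (hQ : UniqueDiffOn ℝ (Q Ω)) (h₁ : Λ₁.IsSymm) (h₂ : Λ₂.IsSymm)
    {Φ : ℝ × E d → Mat n n} (hΦ : IsC1 Ω Φ) {μ : Triple (Q Ω) n k} {ν : Measure (Q Ω)}
    (hν : IsReference μ ν) :
    IsSubgradient Λ₁ Λ₂ μ (LOp D Ω Φ) ↔
      Φ ∈ dualFeasible D Λ₁ Λ₂ Ω ∧ IsPSDValued μ.G ∧ PointwiseOptimal D Λ₁ Λ₂ Φ μ ν := by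
  have := compactSpace_Q (Ω := Ω)
  have hc := continuous_LOp hQ D hΦ
  rw [isSubgradient_iff h₁ h₂ hc fun z => isSymm_dirDeriv hΦ _ z.2]
  constructor
  · rintro ⟨hO, heq⟩
    exact ⟨⟨hΦ, hO⟩, (action_eq_pairing3_iff h₁ h₂ hν hc hO).1 heq⟩
  · rintro ⟨⟨-, hO⟩, h⟩
    exact ⟨hO, (action_eq_pairing3_iff h₁ h₂ hν hc hO).2 h⟩

/-- `Φ` and `μ ∈ CE` are related by `L Φ ∈ ∂𝒥_Λ(μ)` if and only if `Φ` is feasible and its dual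
objective equals the action of `μ`. -/
lemma isSubgradient_LOp_iff_action_eq (hQ : UniqueDiffOn ℝ (Q Ω)) (h₁ : Λ₁.IsSymm)
    (h₂ : Λ₂.IsSymm) {Φ : ℝ × E d → Mat n n} (hΦ : IsC1 Ω Φ) {μ : Triple (Q Ω) n k}
    (hμ : μ ∈ CE D G₀ G₁) :
    IsSubgradient Λ₁ Λ₂ μ (LOp D Ω Φ) ↔ Φ ∈ dualFeasible D Λ₁ Λ₂ Ω ∧
      (action Λ₁ Λ₂ μ : EReal) = ((endPairing G₀ G₁ Φ : ℝ) : EReal) := by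
  have := compactSpace_Q (Ω := Ω)
  rw [isSubgradient_iff h₁ h₂ (continuous_LOp hQ D hΦ) fun z => isSymm_dirDeriv hΦ _ z.2,
    hμ Φ hΦ]
  exact and_congr_left fun _ => ⟨fun h => ⟨hΦ, h⟩, fun h => h.2⟩

lemma IsSubgradient.isMinimizer (hQ : UniqueDiffOn ℝ (Q Ω)) (h₁ : Λ₁.IsSymm)
    (h₂ : Λ₂.IsSymm) {Φ : ℝ × E d → Mat n n} (hΦ : IsC1 Ω Φ) {μ : Triple (Q Ω) n k}
    (hμ : μ ∈ CE D G₀ G₁) (h : IsSubgradient Λ₁ Λ₂ μ (LOp D Ω Φ)) :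
    IsMinimizer D Λ₁ Λ₂ G₀ G₁ μ := by
  obtain ⟨hf, heq⟩ := (isSubgradient_LOp_iff_action_eq hQ h₁ h₂ hΦ hμ).1 h
  refine ⟨hμ, fun ν hν => EReal.coe_ennreal_le_coe_ennreal_iff.1 ?_⟩
  rw [heq]
  exact (le_iSup₂ (f := fun Φ (_ : Φ ∈ dualFeasible D Λ₁ Λ₂ Ω) =>
    ((endPairing G₀ G₁ Φ : ℝ) : EReal)) Φ hf).trans (dualValue_le_action hQ hν)

/-- A field is dual optimal if and only if its image under `L` is a subgradient at some solution of
the continuity equation. -/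
lemma isDualMaximizer_iff (hQ : UniqueDiffOn ℝ (Q Ω)) (h₁ : Λ₁.IsSymm) (h₂ : Λ₂.PosDef)
    (hG₀ : IsPSDValued G₀) (hG₁ : IsPSDValued G₁) {Φ : ℝ × E d → Mat n n} (hΦ : IsC1 Ω Φ) :
    IsDualMaximizer D Λ₁ Λ₂ G₀ G₁ Φ ↔
      ∃ μ : Triple (Q Ω) n k, IsSubgradient Λ₁ Λ₂ μ (LOp D Ω Φ) ∧ μ ∈ CE D G₀ G₁ := by
  have h₂s : Λ₂.IsSymm := ((posSemidef_iff_real _).1 h₂.posSemidef).1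
  constructor
  · rintro ⟨hf, heq⟩
    obtain ⟨μ, hμ, hle, -⟩ := exists_mem_CE_action_le (D := D) hQ h₁ h₂ hG₀ hG₁
    refine ⟨μ, (isSubgradient_LOp_iff_action_eq hQ h₁ h₂s hΦ hμ).2 ⟨hf, ?_⟩, hμ⟩
    rw [heq]
    exact le_antisymm hle (dualValue_le_action hQ hμ)
  · rintro ⟨μ, hs, hμ⟩
    obtain ⟨hf, heq⟩ := (isSubgradient_LOp_iff_action_eq hQ h₁ h₂s hΦ hμ).1 hs
    refine ⟨hf, le_antisymm ?_ (heq ▸ dualValue_le_action hQ hμ)⟩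
    exact le_iSup₂ (f := fun Φ (_ : Φ ∈ dualFeasible D Λ₁ Λ₂ Ω) =>
      ((endPairing G₀ G₁ Φ : ℝ) : EReal)) Φ hf

end Duality

end MatOT

theorem theorem3 {d n k : ℕ} (U : Set (EuclideanSpace ℝ (Fin d))) (hU_open : IsOpen U)
    (hU_conv : Convex ℝ U) (hU_bdd : Bornology.IsBounded U)
    (Ω : Set (EuclideanSpace ℝ (Fin d))) (hΩ : Ω = closure U)
    (D : DiffOp d n k) (Λ₁ : Matrix (Fin k) (Fin k) ℝ) (hΛ₁ : Λ₁.PosSemidef)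
    (Λ₂ : Matrix (Fin n) (Fin n) ℝ) (hΛ₂ : Λ₂.PosDef)
    (G₀ G₁ : MeasureTheory.VectorMeasure Ω (Matrix (Fin n) (Fin n) ℝ))
    (hG₀ : IsPSDValued G₀) (hG₁ : IsPSDValued G₁) :
    -- the primal problem has a minimizer, of finite action
    (∃ μ : Triple (Q Ω) n k, IsMinimizer D Λ₁ Λ₂ G₀ G₁ μ) ∧
    WBsq D Λ₁ Λ₂ G₀ G₁ ≠ ⊤ ∧
    -- there is no duality gap
    (WBsq D Λ₁ Λ₂ G₀ G₁ : EReal) = dualValue D Λ₁ Λ₂ G₀ G₁ ∧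
    -- characterization of the dual maximizers
    ∀ Φ : ℝ × EuclideanSpace ℝ (Fin d) → Matrix (Fin n) (Fin n) ℝ, IsC1 Ω Φ →
      (IsDualMaximizer D Λ₁ Λ₂ G₀ G₁ Φ ↔
        ∃ μ : Triple (Q Ω) n k, IsSubgradient Λ₁ Λ₂ μ (LOp D Ω Φ) ∧ μ ∈ CE D G₀ G₁) ∧
      (IsDualMaximizer D Λ₁ Λ₂ G₀ G₁ Φ ↔
        Φ ∈ dualFeasible D Λ₁ Λ₂ Ω ∧
          ∃ μ ∈ CE D G₀ G₁, IsPSDValued μ.G ∧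
            ∀ ν, IsReference μ ν → PointwiseOptimal D Λ₁ Λ₂ Φ μ ν) ∧
      -- the two conditions agree for each `μ`, whatever the reference measure
      (∀ μ ∈ CE D G₀ G₁, ∀ ν, IsReference μ ν →
        (IsSubgradient Λ₁ Λ₂ μ (LOp D Ω Φ) ↔
          Φ ∈ dualFeasible D Λ₁ Λ₂ Ω ∧ IsPSDValued μ.G ∧
            PointwiseOptimal D Λ₁ Λ₂ Φ μ ν)) ∧
      -- in this case `μ` is a minimizer of the primal problem
      (∀ μ ∈ CE D G₀ G₁, IsSubgradient Λ₁ Λ₂ μ (LOp D Ω Φ) →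
        IsMinimizer D Λ₁ Λ₂ G₀ G₁ μ) := by
  have : CompactSpace Ω := by
    refine isCompact_iff_compactSpace.1 ?_
    rw [hΩ]
    exact hU_bdd.isCompact_closure
  have hQ : UniqueDiffOn ℝ (Q Ω) := uniqueDiffOn_Q hU_open hU_conv hΩ
  have h₁ : Λ₁.IsSymm := ((posSemidef_iff_real _).1 hΛ₁).1
  have h₂ : Λ₂.IsSymm := ((posSemidef_iff_real _).1 hΛ₂.posSemidef).1
  obtain ⟨μ₀, hμ₀, hle, htop⟩ := exists_mem_CE_action_le (D := D) hQ h₁ hΛ₂ hG₀ hG₁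
  have hWB := WBsq_eq_action hQ hμ₀ hle
  refine ⟨⟨μ₀, hμ₀, fun ν hν => EReal.coe_ennreal_le_coe_ennreal_iff.1
    (hle.trans (dualValue_le_action hQ hν))⟩, hWB ▸ htop, ?_, fun Φ hΦ => ?_⟩
  · rw [hWB]
    exact le_antisymm hle (dualValue_le_action hQ hμ₀)
  · have hmax := isDualMaximizer_iff (D := D) hQ h₁ hΛ₂ hG₀ hG₁ hΦ
    refine ⟨hmax, ?_, fun μ _ ν hν => isSubgradient_LOp_iff hQ h₁ h₂ hΦ hν,
      fun μ hμ h => h.isMinimizer hQ h₁ h₂ hΦ hμ⟩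
    rw [hmax]
    constructor
    · rintro ⟨μ, hs, hμ⟩
      have h := (isSubgradient_LOp_iff hQ h₁ h₂ hΦ (isReference_refMeasure μ)).1 hs
      exact ⟨h.1, μ, hμ, h.2.1,
        fun ν hν => ((isSubgradient_LOp_iff hQ h₁ h₂ hΦ hν).1 hs).2.2⟩
    · rintro ⟨hf, μ, hμ, hpsd, hopt⟩
      exact ⟨μ, (isSubgradient_LOp_iff hQ h₁ h₂ hΦ (isReference_refMeasure μ)).2
        ⟨hf, hpsd, hopt _ (isReference_refMeasure μ)⟩, hμ⟩
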